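/- Fix $\varepsilon>0$ (the lattice step) and $m>0$ (the particle mass), and consider the lattice $\varepsilon\mathbb{Z}^2=\{(x,t): x/\varepsilon,\,t/\varepsilon\in\mathbb{Z}\}$. A *checker path* $s$ is a finite sequence of lattice points such that the vector from each point (except the last one) to the next one equals either $(\varepsilon,\varepsilon)$ or $(-\varepsilon,\varepsilon)$. Let $\mathrm{turns}(s)$ be the number of points of $s$ (not the first and not the last one) such that the vectors from the point to the next and to the previous ones are orthogonal. For $(x,t)\in\varepsilon\mathbb{Z}^2$ with $t>0$ put $$a(x,t,m,\varepsilon):=(1+m^2\varepsilon^2)^{(1-t/\varepsilon)/2}\; i\,\sum_s(-im\varepsilon)^{\mathrm{turns}(s)},$$ where the sum is over all checker paths $s$ from $(0,0)$ to $(x,t)$ with the first step to $(\varepsilon,\varepsilon)$ (an empty sum is $0$), and let $a_1:=\mathrm{Re}\,a$, $a_2:=\mathrm{Im}\,a$. Further, put $$\theta(x,t,m,\varepsilon):=\frac{t}{\varepsilon}\arcsin\frac{m\varepsilon t}{\sqrt{(1+m^2\varepsilon^2)(t^2-x^2)}}-\frac{x}{\varepsilon}\arcsin\frac{m\varepsilon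 x}{\sqrt{t^2-x^2}}+\frac{\pi}{4}.$$ **Theorem (large-time asymptotic formula between the peaks).** For each $\delta>0$ there are $C_\delta>0$ and $K_\delta>0$, depending only on $\delta$, such that for all $m,\varepsilon>0$ and each $(x,t)\in\varepsilon\mathbb{Z}^2$ satisfying $$\frac{|x|}{t}<\frac{1}{\sqrt{1+m^2\varepsilon^2}}-\delta,\qquad \varepsilon\le\frac1m,\qquad t>\frac{C_\delta}{m},$$ the following holds. If $(x+t)/\varepsilon$ is odd, then $$\left|a_1(x,t+\varepsilon,m,\varepsilon)-\varepsilon\sqrt{\frac{2m}{\pi}}\left(t^2-(1+m^2\varepsilon^2)x^2\right)^{-1/4}\sin\theta(x,t,m,\varepsilon)\right|\le K_\delta\,\frac{\varepsilon}{m^{1/2}t^{3/2}}.$$ If $(x+t)/\varepsilon$ is even, then $$\left|a_2(x+\varepsilon,t+\varepsilon,m,\varepsilon)-\varepsilon\sqrt{\frac{2m}{\pi}}\left(t^2-(1+m^2\varepsilon^2)x^2\right)^{-1/4}\sqrt{\frac{t+x}{t-x}}\,\cos\theta(x,t,m,\varepsilon)\right|\le K_\delta\,\frac{\varepsilon}{m^{1/2}t^{3/2}}.$$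 -/

import Mathlib

namespace FeynmanCheckers

/-- The lattice `ε ℤ²`, consisting of the points `(x, t)` with `x / ε` and `t / ε` integers. -/
def lattice (ε : ℝ) : Set (ℝ × ℝ) :=
  {p | ∃ i j : ℤ, p = (i * ε, j * ε)}

/-- The vector from `p` to `q` equals either `(ε, ε)` or `(-ε, ε)`. -/
def IsStep (ε : ℝ) (p q : ℝ × ℝ) : Prop :=
  q - p = (ε, ε) ∨ q - p = (-ε, ε)

/-- A checker path on `ε ℤ²`, given as the list of its points in order. -/
def IsCheckerPath (ε : ℝ) (s : List (ℝ × ℝ)) : Prop :=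
  (∀ p ∈ s, p ∈ lattice ε) ∧ s.IsChain (IsStep ε)

/-- Checker paths from `(0, 0)` to `(x, t)` with the first step to `(ε, ε)`. -/
def paths (ε x t : ℝ) : Set (List (ℝ × ℝ)) :=
  {s | IsCheckerPath ε s ∧ s[0]? = some (0, 0) ∧ s[1]? = some (ε, ε) ∧
    s.getLast? = some (x, t)}

/-- `q` is a turn between `p` and `r`: the vectors from `q` to the next point `r` and to the
previous point `p` are orthogonal. -/
def IsTurn (p q r : ℝ × ℝ) : Prop :=
  (r.1 - q.1) * (p.1 - q.1) + (r.2 - q.2) * (p.2 - q.2) = 0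

open Classical in
/-- The number of turns, counted over all points except the first and the last one. -/
noncomputable def turns : List (ℝ × ℝ) → ℕ
  | p :: q :: r :: l => (if IsTurn p q r then 1 else 0) + turns (q :: r :: l)
  | _ => 0

/-- The arrow `a(x, t, m, ε)`. The sum is over a finite set, see `finite_paths`. -/
noncomputable def arrow (x t m ε : ℝ) : ℂ :=
  (((1 + m ^ 2 * ε ^ 2) ^ ((1 - t / ε) / 2) : ℝ) : ℂ) * Complex.I *
    ∑ᶠ s ∈ paths ε x t, (-Complex.I * m * ε) ^ turns s

/-- `a₁ = Re a`. -/
noncomputable def a₁ (x t m ε : ℝ) : ℝ := (arrow x t m ε).re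

/-- `a₂ = Im a`. -/
noncomputable def a₂ (x t m ε : ℝ) : ℝ := (arrow x t m ε).im

/-- The phase of the large-time asymptotic formula. -/
noncomputable def theta (x t m ε : ℝ) : ℝ :=
  t / ε * Real.arcsin (m * ε * t / √((1 + m ^ 2 * ε ^ 2) * (t ^ 2 - x ^ 2)))
    - x / ε * Real.arcsin (m * ε * x / √(t ^ 2 - x ^ 2)) + Real.pi / 4

theorem finite_chains (ε : ℝ) (n : ℕ) (p : ℝ × ℝ) :
    {s : List (ℝ × ℝ) | s.length = n ∧ (p :: s).IsChain (IsStep ε)}.Finite := by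
  induction n generalizing p with
  | zero =>
    refine (Set.finite_singleton []).subset ?_
    rintro s ⟨hs, -⟩
    simpa using hs
  | succ n ih =>
    refine (((ih (p + (ε, ε))).image (fun s => (p + (ε, ε)) :: s)).union
      ((ih (p + (-ε, ε))).image (fun s => (p + (-ε, ε)) :: s))).subset ?_
    rintro s ⟨hs, hc⟩
    cases s with
    | nil => simp at hs
    | cons q s =>
      rw [List.isChain_cons_cons] at hc
      obtain ⟨h | h, hc⟩ := hc
      · have hq : q = p + (ε, ε) := by rw [← h]; abel
        subst hq
        exact Or.inl ⟨s, ⟨by simpa using hs, hc⟩, rfl⟩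
      · have hq : q = p + (-ε, ε) := by rw [← h]; abel
        subst hq
        exact Or.inr ⟨s, ⟨by simpa using hs, hc⟩, rfl⟩

theorem snd_getLast (ε : ℝ) (s : List (ℝ × ℝ)) (p : ℝ × ℝ)
    (h : (p :: s).IsChain (IsStep ε)) (q : ℝ × ℝ) (hq : (p :: s).getLast? = some q) :
    q.2 = p.2 + s.length * ε := by
  induction s generalizing p with
  | nil => simp at hq; simp [hq]
  | cons r s ih =>
    rw [List.isChain_cons_cons] at h
    have h1 := ih r h.2 (by simpa using hq)
    have h2 : r.2 - p.2 = ε := by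
      rcases h.1 with h | h <;> exact congrArg Prod.snd h
    rw [h1]
    push_cast [List.length_cons]
    linarith

/-- There are finitely many checker paths to each point. -/
theorem finite_paths {ε : ℝ} (hε : 0 < ε) (x t : ℝ) : (paths ε x t).Finite := by
  refine ((finite_chains ε ⌊t / ε⌋₊ (0, 0)).image (fun s => (0, 0) :: s)).subset ?_
  rintro s ⟨⟨-, hc⟩, h0, -, hl⟩
  cases s with
  | nil => simp at h0
  | cons p s =>
    obtain rfl : p = (0, 0) := by simpa using h0
    have h := snd_getLast ε s (0, 0) hc (x, t) hl
    refine ⟨s, ⟨?_, hc⟩, rfl⟩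
    have ht : t / ε = s.length := by
      simp only [zero_add] at h
      rw [h, mul_div_assoc, div_self hε.ne', mul_one]
    rw [ht, Nat.floor_natCast]

end FeynmanCheckers

/-! Put μ = mε, n = t/ε, v = x/t. Counting paths by their straight blocks (`turnSum`,
`pathSum_reach`) turns the arrow into hypergeometric polynomials: the two components are μ · `wave
0` and -μ² · `wave 1` (`a₁_eq`, `a₂_eq`). The key point is to freeze n and v and let μ grow from 0,
where the waves are explicit. In the variable arctan μ they solve a second-order equation
(`SolvesWave`) with a Bessel-type singularity at μ = 0 and leading frequency n · `rate v μ`, where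
rate² = 1 - v²(1 + μ²). Being between the peaks means that the rate stays away from 0, so there is
no turning point up to μ = mε. The integral of the rate is the explicit function `phase`, and n ·
phase + π/4 is θ (`theta_eq`).

A Liouville–Green (Langer) substitution therefore turns `gain` · wave into a solution of Bessel's
equation of order 0 or 1 in z = n · phase, up to a perturbation of relative size 1/n. The initial
data at μ = 0 select J₀(z) and J₁(z), and an energy estimate started at μ = 0 (`energy_le`,
`perturbed_bessel`, `solvesWave_bessel`) bounds the difference by a multiple of √μ n^(-3/2),
uniformly in μ ≤ 1.

It remains to know J₀ and J₁ at infinity. The vector √z (J₀, J₁) rotates with amplitudes that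
converge at rate 1/z (`amp_sub_le`). Their limits are read off from the same comparison at v = 0, μ
= 1: there the polynomial is an alternating sum of squared binomials, hence 0 or ± a central
binomial coefficient, and Wallis' product yields √(2/π). `wave_asymptotics` joins the two
approximations. -/

namespace FeynmanCheckers

/-! ### Hypergeometric polynomials and their Pascal-type recurrences. -/

open Polynomial in
/-- The polynomial `∑ C(A, r + α) C(B, r) X ^ r`. -/
noncomputable def hyperPoly (α A B : ℕ) : Polynomial ℝ :=
  ∑ r ∈ Finset.range (B + 1), Polynomial.C ((A.choose (r + α) * B.choose r : ℕ) : ℝ) * X ^ r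

theorem coeff_hyperPoly (α A B r : ℕ) :
    (hyperPoly α A B).coeff r = ((A.choose (r + α) * B.choose r : ℕ) : ℝ) := by
  simp only [hyperPoly, Polynomial.finsetSum_coeff, Polynomial.coeff_C_mul_X_pow]
  rw [Finset.sum_ite_eq]
  split_ifs with h
  · rfl
  · rw [Nat.choose_eq_zero_of_lt (n := B) (by simpa [Nat.lt_succ_iff] using h)]
    simp

theorem hyperPoly_zero_comm (A B : ℕ) : hyperPoly 0 A B = hyperPoly 0 B A := by
  ext r
  simp [coeff_hyperPoly, mul_comm]

theorem hyperPoly_zero_succ (A B : ℕ) :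
    hyperPoly 0 (A + 1) B = hyperPoly 0 A B + Polynomial.X * hyperPoly 1 B A := by
  ext r
  cases r with
  | zero => simp [coeff_hyperPoly]
  | succ r =>
    rw [Polynomial.coeff_add, Polynomial.coeff_X_mul]
    simp only [coeff_hyperPoly, Nat.add_zero, Nat.choose_succ_succ]
    push_cast
    ring

theorem hyperPoly_one_succ (A B : ℕ) :
    hyperPoly 1 (A + 1) B = hyperPoly 1 A B + hyperPoly 0 A B := by
  ext r
  rw [Polynomial.coeff_add]
  simp only [coeff_hyperPoly, Nat.add_zero, Nat.choose_succ_succ]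
  push_cast
  ring

theorem hyperPoly_zero_zero (B : ℕ) : hyperPoly 0 0 B = 1 := by
  ext r
  rcases r with _ | r <;> simp [coeff_hyperPoly, Polynomial.coeff_one]

theorem hyperPoly_one_zero (B : ℕ) : hyperPoly 1 0 B = 0 := by
  ext r
  simp [coeff_hyperPoly]

/-! ### Summation over checker paths by number of turns. -/

/-- Continuations of length `n` of a checker path from `p` to `q`. -/
def pathsFrom (ε : ℝ) (p q : ℝ × ℝ) (n : ℕ) : Set (List (ℝ × ℝ)) :=
  {s | s.length = n ∧ (p :: s).IsChain (IsStep ε) ∧ (p :: s).getLast? = some q}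

theorem finite_pathsFrom (ε : ℝ) (p q : ℝ × ℝ) (n : ℕ) : (pathsFrom ε p q n).Finite :=
  (finite_chains ε n p).subset fun _ hs => ⟨hs.1, hs.2.1⟩

/-- The sum of `z ^ turns` over the continuations of a path that arrived at `p` by the step `d`. -/
noncomputable def pathSum (ε : ℝ) (z : ℂ) (d p q : ℝ × ℝ) (n : ℕ) : ℂ :=
  ∑ᶠ s ∈ pathsFrom ε p q n, z ^ turns ((p - d) :: p :: s)

theorem pathsFrom_succ (ε : ℝ) (p q : ℝ × ℝ) (n : ℕ) :
    pathsFrom ε p q (n + 1) = (fun s => (p + (ε, ε)) :: s) '' pathsFrom ε (p + (ε, ε)) q n ∪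
      (fun s => (p + (-ε, ε)) :: s) '' pathsFrom ε (p + (-ε, ε)) q n := by
  ext s
  constructor
  · rintro ⟨hs, hc, hl⟩
    cases s with
    | nil => simp at hs
    | cons r s =>
      rw [List.isChain_cons_cons] at hc
      rw [List.getLast?_cons_cons] at hl
      obtain ⟨h | h, hc⟩ := hc
      · obtain rfl : r = p + (ε, ε) := by rw [← h]; abel
        exact Or.inl ⟨s, ⟨by simpa using hs, hc, hl⟩, rfl⟩
      · obtain rfl : r = p + (-ε, ε) := by rw [← h]; abel
        exact Or.inr ⟨s, ⟨by simpa using hs, hc, hl⟩, rfl⟩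
  · rintro (⟨s, ⟨hs, hc, hl⟩, rfl⟩ | ⟨s, ⟨hs, hc, hl⟩, rfl⟩)
    · exact ⟨by simpa using hs, List.isChain_cons_cons.2 ⟨Or.inl (by abel), hc⟩,
        by rwa [List.getLast?_cons_cons]⟩
    · exact ⟨by simpa using hs, List.isChain_cons_cons.2 ⟨Or.inr (by abel), hc⟩,
        by rwa [List.getLast?_cons_cons]⟩

open Classical in
theorem pathSum_succ {ε : ℝ} (hε : 0 < ε) (z : ℂ) (d p q : ℝ × ℝ) (n : ℕ) :
    pathSum ε z d p q (n + 1) =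
      (if IsTurn (p - d) p (p + (ε, ε)) then z else 1) * pathSum ε z (ε, ε) (p + (ε, ε)) q n +
      (if IsTurn (p - d) p (p + (-ε, ε)) then z else 1) *
        pathSum ε z (-ε, ε) (p + (-ε, ε)) q n := by
  have key : ∀ e : ℝ × ℝ, ∑ᶠ s ∈ (fun s => (p + e) :: s) '' pathsFrom ε (p + e) q n,
      z ^ turns ((p - d) :: p :: s) =
      (if IsTurn (p - d) p (p + e) then z else 1) * pathSum ε z e (p + e) q n := by
    intro e
    rw [finsum_mem_image (fun a _ b _ h => List.tail_eq_of_cons_eq h), pathSum,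
      ← smul_eq_mul, smul_finsum_mem (finite_pathsFrom _ _ _ _)]
    refine finsum_mem_congr rfl fun s _ => ?_
    simp only [turns, add_sub_cancel_right, pow_add]
    split_ifs <;> simp
  rw [pathSum, pathsFrom_succ, finsum_mem_union ?_ ((finite_pathsFrom _ _ _ _).image _)
    ((finite_pathsFrom _ _ _ _).image _), key, key]
  rw [Set.disjoint_left]
  rintro _ ⟨s, -, rfl⟩ ⟨s', -, h⟩
  have := congrArg Prod.fst (List.head_eq_of_cons_eq h)
  simp at this
  linarith

theorem pathSum_right_succ {ε : ℝ} (hε : 0 < ε) (z : ℂ) (p q : ℝ × ℝ) (n : ℕ) :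
    pathSum ε z (ε, ε) p q (n + 1) = pathSum ε z (ε, ε) (p + (ε, ε)) q n +
      z * pathSum ε z (-ε, ε) (p + (-ε, ε)) q n := by
  rw [pathSum_succ hε, if_neg, if_pos, one_mul]
  · simp [IsTurn]
  · simp only [IsTurn, Prod.fst_add, Prod.snd_add, Prod.fst_sub, Prod.snd_sub]
    nlinarith [mul_pos hε hε]

theorem pathSum_left_succ {ε : ℝ} (hε : 0 < ε) (z : ℂ) (p q : ℝ × ℝ) (n : ℕ) :
    pathSum ε z (-ε, ε) p q (n + 1) = z * pathSum ε z (ε, ε) (p + (ε, ε)) q n +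
      pathSum ε z (-ε, ε) (p + (-ε, ε)) q n := by
  rw [pathSum_succ hε, if_pos, if_neg, one_mul]
  · simp only [IsTurn, Prod.fst_add, Prod.snd_add, Prod.fst_sub, Prod.snd_sub]
    nlinarith [mul_pos hε hε]
  · simp [IsTurn]

theorem pathSum_zero_self (ε : ℝ) (z : ℂ) (d p : ℝ × ℝ) : pathSum ε z d p p 0 = 1 := by
  have : pathsFrom ε p p 0 = {[]} := by
    ext s
    constructor
    · rintro ⟨hs, -⟩
      simpa using hs
    · rintro rfl
      exact ⟨rfl, by simp, by simp⟩
  rw [pathSum, this, finsum_mem_singleton]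
  simp [turns]

theorem pathSum_eq_zero {ε : ℝ} (hε : 0 < ε) (z : ℂ) (d p q : ℝ × ℝ) (n : ℕ)
    (h : n * ε < |q.1 - p.1|) : pathSum ε z d p q n = 0 := by
  have : pathsFrom ε p q n = ∅ := by
    induction n generalizing p with
    | zero =>
      rw [Set.eq_empty_iff_forall_notMem]
      rintro s ⟨hs, -, hl⟩
      obtain rfl : s = [] := by simpa using hs
      obtain rfl : p = q := by simpa using hl
      simp at h
    | succ n ih =>
      push_cast at h
      rw [pathsFrom_succ, ih, ih, Set.image_empty, Set.image_empty, Set.union_empty]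
      · have := abs_sub_abs_le_abs_sub (q.1 - p.1) (-ε)
        rw [abs_neg, abs_of_pos hε] at this
        have e : q.1 - (p + (-ε, ε)).1 = q.1 - p.1 - -ε := by simp; ring
        rw [e]; linarith
      · have := abs_sub_abs_le_abs_sub (q.1 - p.1) ε
        rw [abs_of_pos hε] at this
        have e : q.1 - (p + (ε, ε)).1 = q.1 - p.1 - ε := by simp; ring
        rw [e]; linarith
  rw [pathSum, this, finsum_mem_empty]

/-- The point reached from `p` by `i` steps to the right and `j` steps to the left. -/
def reach (ε : ℝ) (p : ℝ × ℝ) (i j : ℕ) : ℝ × ℝ := p + (((i : ℝ) - j) * ε, ((i : ℝ) + j) * ε)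

theorem reach_succ_left (ε : ℝ) (p : ℝ × ℝ) (i j : ℕ) :
    reach ε p (i + 1) j = reach ε (p + (ε, ε)) i j := by
  ext <;> simp [reach] <;> ring

theorem reach_succ_right (ε : ℝ) (p : ℝ × ℝ) (i j : ℕ) :
    reach ε p i (j + 1) = reach ε (p + (-ε, ε)) i j := by
  ext <;> simp [reach] <;> ring

/-- The sum of `z ^ turns` over the paths with `i` more right steps and `j` more left steps, where
the last step was to the right and `w = z ^ 2`. -/
noncomputable def turnSum (z : ℂ) (w : ℝ) (i : ℕ) : ℕ → ℂ
  | 0 => 1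
  | j + 1 => z ^ 2 * ((hyperPoly 1 i j).eval w : ℝ) + z * ((hyperPoly 0 i j).eval w : ℝ)

theorem turnSum_zero_succ (z : ℂ) (w : ℝ) (j : ℕ) : turnSum z w 0 (j + 1) = z := by
  simp [turnSum, hyperPoly_one_zero, hyperPoly_zero_zero]

/-- The closed form counts blocks of equal steps. With j + 1 left steps in r + 1 blocks there are
C(j, r) choices; the i right steps fill a possibly empty initial block and r or r + 1 further
blocks, in C(i, r) or C(i, r + 1) ways, giving 2r + 1 or 2r + 2 turns. The recursion on the next
step is then Pascal's rule. -/
theorem turnSum_succ_succ {z : ℂ} {w : ℝ} (hz : z ^ 2 = w) (i j : ℕ) :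
    turnSum z w (i + 1) (j + 1) = turnSum z w i (j + 1) + z * turnSum z w j (i + 1) := by
  simp only [turnSum, hyperPoly_one_succ, hyperPoly_zero_succ, hyperPoly_zero_comm j i,
    Polynomial.eval_add, Polynomial.eval_mul, Polynomial.eval_X, Complex.ofReal_add,
    Complex.ofReal_mul, ← hz]
  ring

theorem pathSum_reach {ε : ℝ} (hε : 0 < ε) {z : ℂ} {w : ℝ} (hz : z ^ 2 = w) (l : ℕ) :
    ∀ i j : ℕ, i + j = l → ∀ p : ℝ × ℝ,
    pathSum ε z (ε, ε) p (reach ε p i j) l = turnSum z w i j ∧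
    pathSum ε z (-ε, ε) p (reach ε p i j) l = turnSum z w j i := by
  induction l with
  | zero =>
    intro i j hij p
    obtain ⟨rfl, rfl⟩ : i = 0 ∧ j = 0 := by omega
    have h : reach ε p 0 0 = p := by simp [reach]
    simp [h, pathSum_zero_self, turnSum]
  | succ l ih =>
    intro i j hij p
    rw [pathSum_right_succ hε, pathSum_left_succ hε]
    have hl : ((i : ℝ) + j) = l + 1 := by exact_mod_cast hij
    -- On the boundary one of the two continuations can no longer reach the endpoint and contributes
    -- 0.
    rcases i with _ | i <;> rcases j with _ | j
    · omega
    · rw [pathSum_eq_zero hε (p := p + (ε, ε)), reach_succ_right, (ih 0 j (by omega) _).2,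
        turnSum_zero_succ]
      · simp [turnSum]
      · simp only [reach, Prod.fst_add]
        refine lt_of_lt_of_le ?_ (neg_le_abs _)
        push_cast at hl ⊢
        nlinarith
    · rw [pathSum_eq_zero hε (p := p + (-ε, ε)), reach_succ_left, (ih i 0 (by omega) _).1,
        turnSum_zero_succ]
      · simp [turnSum]
      · simp only [reach, Prod.fst_add]
        refine lt_of_lt_of_le ?_ (le_abs_self _)
        push_cast at hl ⊢
        nlinarith
    · have h1 := ih i (j + 1) (by omega) (p + (ε, ε))
      have h2 := ih (i + 1) j (by omega) (p + (-ε, ε))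
      rw [← reach_succ_left] at h1
      rw [← reach_succ_right] at h2
      rw [h1.1, h2.2, turnSum_succ_succ hz, turnSum_succ_succ hz, add_comm (z * _)]
      simp

theorem finsum_paths (ε : ℝ) (z : ℂ) (x t : ℝ) (n : ℕ) (ht : t = (n + 1) * ε) (hε : 0 < ε) :
    ∑ᶠ s ∈ paths ε x t, z ^ turns s = pathSum ε z (ε, ε) (ε, ε) (x, t) n := by
  have hp : paths ε x t =
      (fun s => (0, 0) :: (ε, ε) :: s) '' pathsFrom ε (ε, ε) (x, t) n := by
    ext s
    constructor
    · rintro ⟨⟨-, hc⟩, h0, h1, hl⟩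
      rcases s with _ | ⟨p, _ | ⟨q, s⟩⟩
      · simp at h0
      · simp at h1
      obtain rfl : p = (0, 0) := by simpa using h0
      obtain rfl : q = (ε, ε) := by simpa using h1
      have h := snd_getLast ε _ _ hc _ hl
      rw [List.isChain_cons_cons] at hc
      rw [List.getLast?_cons_cons] at hl
      refine ⟨s, ⟨?_, hc.2, hl⟩, rfl⟩
      simp only [ht, zero_add] at h
      have := mul_right_cancel₀ hε.ne' h
      push_cast [List.length_cons] at this
      exact_mod_cast (add_right_cancel this).symm
    · rintro ⟨s, ⟨hs, hc, hl⟩, rfl⟩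
      have hc' : ((0, 0) :: (ε, ε) :: s).IsChain (IsStep ε) :=
        List.isChain_cons_cons.2 ⟨Or.inl (by simp), hc⟩
      refine ⟨⟨?_, hc'⟩, rfl, rfl, by simpa [List.getLast?_cons_cons] using hl⟩
      -- The lattice condition is automatic: every step from a lattice point ends at a lattice
      -- point.
      have key : ∀ (s : List (ℝ × ℝ)) (p : ℝ × ℝ), p ∈ lattice ε → (p :: s).IsChain (IsStep ε) →
          ∀ q ∈ p :: s, q ∈ lattice ε := by
        intro s
        induction s with
        | nil => intro p hp _ q hq; simpa [List.mem_singleton.1 hq] using hp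
        | cons r s ih =>
          intro p hp hc q hq
          rw [List.isChain_cons_cons] at hc
          rcases List.mem_cons.1 hq with rfl | hq
          · exact hp
          refine ih r ?_ hc.2 q hq
          obtain ⟨i, j, rfl⟩ := hp
          rcases hc.1 with h | h
          · refine ⟨i + 1, j + 1, ?_⟩
            rw [sub_eq_iff_eq_add.1 h]
            ext <;> simp <;> ring
          · refine ⟨i - 1, j + 1, ?_⟩
            rw [sub_eq_iff_eq_add.1 h]
            ext <;> simp <;> ring
      exact key _ _ ⟨0, 0, by simp⟩ hc'
  rw [hp, finsum_mem_image, pathSum]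
  · simp [← Prod.zero_eq_mk]
  · intro a _ b _ h
    simpa using h

/-- After the prescribed first step, A right and B + 1 left steps remain. With z = -iμ, odd numbers
of turns give, after the factor i, the real part, and even numbers the imaginary part; this
separates the two polynomials. -/
theorem arrow_eq {m ε : ℝ} (hε : 0 < ε) (A B : ℕ) :
    arrow (((A : ℝ) - B) * ε) (((A : ℝ) + B + 2) * ε) m ε =
      ((m * ε * ((1 + (m * ε) ^ 2) ^ (-((A : ℝ) + B + 1) / 2) *
        (hyperPoly 0 A B).eval (-(m * ε) ^ 2)) : ℝ) : ℂ) +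
      ((-(m * ε) ^ 2 * ((1 + (m * ε) ^ 2) ^ (-((A : ℝ) + B + 1) / 2) *
        (hyperPoly 1 A B).eval (-(m * ε) ^ 2)) : ℝ) : ℂ) * Complex.I := by
  have hz : (-Complex.I * m * ε) ^ 2 = ((-(m * ε) ^ 2 : ℝ) : ℂ) := by
    push_cast
    linear_combination (m ^ 2 * ε ^ 2 : ℂ) * Complex.I_sq
  have hr : ((((A : ℝ) - B) * ε, ((A : ℝ) + B + 2) * ε) : ℝ × ℝ) =
      reach ε (ε, ε) A (B + 1) := by
    ext <;> simp [reach] <;> ring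
  rw [arrow, finsum_paths ε _ _ _ (A + B + 1) (by push_cast; ring) hε, hr,
    (pathSum_reach hε hz (A + B + 1) A (B + 1) (by ring) (ε, ε)).1, turnSum, hz, mul_div_assoc,
    div_self hε.ne', mul_one,
    show (1 - ((A : ℝ) + B + 2)) / 2 = -((A : ℝ) + B + 1) / 2 by ring, ← mul_pow]
  push_cast
  linear_combination (-(((1 + (m * ε) ^ 2) ^ (-((A : ℝ) + B + 1) / 2) : ℝ) : ℂ) * m * ε *
    ((hyperPoly 0 A B).eval (-(m * ε) ^ 2) : ℝ)) * Complex.I_sq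

theorem a₁_eq {m ε : ℝ} (hε : 0 < ε) (A B : ℕ) :
    a₁ (((A : ℝ) - B) * ε) (((A : ℝ) + B + 2) * ε) m ε =
      m * ε * ((1 + (m * ε) ^ 2) ^ (-((A : ℝ) + B + 1) / 2) *
        (hyperPoly 0 A B).eval (-(m * ε) ^ 2)) := by
  rw [a₁, arrow_eq hε, Complex.add_re, Complex.ofReal_re, Complex.re_ofReal_mul, Complex.I_re,
    mul_zero, add_zero]

theorem a₂_eq {m ε : ℝ} (hε : 0 < ε) (A B : ℕ) :
    a₂ (((A : ℝ) - B) * ε) (((A : ℝ) + B + 2) * ε) m ε =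
      -(m * ε) ^ 2 * ((1 + (m * ε) ^ 2) ^ (-((A : ℝ) + B + 1) / 2) *
        (hyperPoly 1 A B).eval (-(m * ε) ^ 2)) := by
  rw [a₂, arrow_eq hε, Complex.add_im, Complex.ofReal_im, Complex.im_ofReal_mul, Complex.I_im,
    mul_one, zero_add]

/-! ### The differential equation in μ at fixed n and v. -/

-- Up to a constant this is ₂F₁(α - A, -B; 1 + α; z): the ratio of consecutive coefficients, in
-- `key`, is equivalent to Gauss' equation.
open Polynomial in
theorem hyperPoly_ode (α A B : ℕ) (z : ℝ) :
    z * (1 - z) * (derivative (derivative (hyperPoly α A B))).eval z +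
      ((1 + α) + ((A : ℝ) - α + B - 1) * z) * (derivative (hyperPoly α A B)).eval z -
      ((A : ℝ) - α) * B * (hyperPoly α A B).eval z = 0 := by
  have key : ∀ r : ℕ, ((r : ℝ) + 1) * (r + 1 + α) * (hyperPoly α A B).coeff (r + 1) =
      ((A : ℝ) - α - r) * (B - r) * (hyperPoly α A B).coeff r := by
    intro r
    simp only [coeff_hyperPoly]
    have h : ∀ N s : ℕ, ((s : ℝ) + 1) * (N.choose (s + 1) : ℝ) = ((N : ℝ) - s) * N.choose s := by
      intro N s
      have h1 := Nat.choose_succ_right_eq N s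
      rcases le_or_gt s N with h2 | h2
      · have h3 : ((N.choose (s + 1) : ℝ)) * (s + 1) = N.choose s * ((N - s : ℕ) : ℝ) := by
          exact_mod_cast h1
        rw [Nat.cast_sub h2] at h3
        linarith
      · rw [Nat.choose_eq_zero_of_lt h2, Nat.choose_eq_zero_of_lt (by omega)]
        simp
    have h1 := h A (r + α)
    have h2 := h B r
    rw [show r + 1 + α = r + α + 1 by ring]
    push_cast at h1 ⊢
    linear_combination ((B.choose (r + 1) : ℝ) * (r + 1)) * h1 +
      ((A : ℝ) - (r + α)) * (A.choose (r + α) : ℝ) * h2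
  have hp : X * derivative (derivative (hyperPoly α A B)) -
      X * (X * derivative (derivative (hyperPoly α A B))) +
      Polynomial.C (1 + (α : ℝ)) * derivative (hyperPoly α A B) +
      Polynomial.C ((A : ℝ) - α + B - 1) * (X * derivative (hyperPoly α A B)) -
      Polynomial.C (((A : ℝ) - α) * B) * hyperPoly α A B = 0 := by
    ext r
    rw [coeff_sub, coeff_add, coeff_add, coeff_sub, coeff_C_mul, coeff_C_mul, coeff_C_mul,
      coeff_zero]
    have k := key r
    rcases r with _ | _ | r
    · simp only [coeff_X_mul_zero, coeff_derivative]
      push_cast at k ⊢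
      linarith
    · simp only [coeff_X_mul, zero_add, coeff_X_mul_zero, coeff_derivative]
      push_cast at k ⊢
      linarith
    · simp only [coeff_X_mul, coeff_derivative]
      push_cast at k ⊢
      linarith
  have := congrArg (eval z) hp
  simp only [eval_sub, eval_add, eval_mul, eval_X, eval_C, eval_zero] at this
  linarith

/-- `F` solves on `(0, ∞)` the equation
`D² F + (1 + μ²) / μ * D F + (n² + (1 - n² v²) (1 + μ²) - a (1 + μ²) / μ²) F = 0`,
where `D = (1 + μ²) d/dμ` and `F' = D F`. -/
def SolvesWave (a n v : ℝ) (F F' : ℝ → ℝ) : Prop :=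
  ∀ μ : ℝ, 0 < μ → HasDerivAt F (F' μ / (1 + μ ^ 2)) μ ∧
    HasDerivAt F' ((-((1 + μ ^ 2) / μ * F' μ) - (n ^ 2 + (1 - n ^ 2 * v ^ 2) * (1 + μ ^ 2) -
      a * ((1 + μ ^ 2) / μ ^ 2)) * F μ) / (1 + μ ^ 2)) μ

/-- The common factor of the two components of the arrow. -/
noncomputable def wave (α A B : ℕ) (μ : ℝ) : ℝ :=
  (1 + μ ^ 2) ^ (-((A : ℝ) + B + 1) / 2) * (hyperPoly α A B).eval (-μ ^ 2)

/-- The derivative of `wave` with respect to `arctan μ`. -/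
noncomputable def waveD (α A B : ℕ) (μ : ℝ) : ℝ :=
  (1 + μ ^ 2) ^ (-((A : ℝ) + B + 1) / 2) * (-((A : ℝ) + B + 1) * μ *
    (hyperPoly α A B).eval (-μ ^ 2) -
    2 * μ * (1 + μ ^ 2) * (Polynomial.derivative (hyperPoly α A B)).eval (-μ ^ 2))

theorem hasDerivAt_eval_neg_sq (p : Polynomial ℝ) (μ : ℝ) :
    HasDerivAt (fun μ : ℝ => p.eval (-μ ^ 2))
      ((Polynomial.derivative p).eval (-μ ^ 2) * (-(2 * μ))) μ := by
  have h : HasDerivAt (fun μ : ℝ => -μ ^ 2) (-(2 * μ)) μ := by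
    convert! (hasDerivAt_pow 2 μ).neg using 1
    simp
  exact (p.hasDerivAt (-μ ^ 2)).comp μ h

theorem hasDerivAt_one_add_sq_rpow (s μ : ℝ) :
    HasDerivAt (fun μ : ℝ => (1 + μ ^ 2) ^ s) ((1 + μ ^ 2) ^ s * (2 * s * μ / (1 + μ ^ 2))) μ := by
  have hp : 0 < 1 + μ ^ 2 := by positivity
  have h : HasDerivAt (fun μ : ℝ => 1 + μ ^ 2) (2 * μ) μ := by
    simpa using (hasDerivAt_pow 2 μ).const_add 1
  convert! h.rpow_const (p := s) (Or.inl hp.ne') using 1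
  rw [Real.rpow_sub_one hp.ne']
  field_simp

theorem hasDerivAt_wave (α A B : ℕ) (μ : ℝ) :
    HasDerivAt (wave α A B) (waveD α A B μ / (1 + μ ^ 2)) μ := by
  have hp : (1 + μ ^ 2) ≠ 0 := by positivity
  convert! (hasDerivAt_one_add_sq_rpow (-((A : ℝ) + B + 1) / 2) μ).mul
    (hasDerivAt_eval_neg_sq (hyperPoly α A B) μ) using 1
  rw [waveD]
  field_simp
  ring

theorem hasDerivAt_waveD (α A B : ℕ) {μ : ℝ} (hμ : 0 < μ) :
    HasDerivAt (waveD α A B) ((-((2 * α + 1) * ((1 + μ ^ 2) / μ) * waveD α A B μ) -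
      (((A : ℝ) + B + 1) ^ 2 + ((1 + α) ^ 2 - ((A : ℝ) - B - α) ^ 2) * (1 + μ ^ 2))
      * wave α A B μ) / (1 + μ ^ 2)) μ := by
  have hp : (1 + μ ^ 2) ≠ 0 := by positivity
  have h1 := hasDerivAt_eval_neg_sq (hyperPoly α A B) μ
  have h2 := hasDerivAt_eval_neg_sq (Polynomial.derivative (hyperPoly α A B)) μ
  have h3 : HasDerivAt (fun μ : ℝ => -((A : ℝ) + B + 1) * μ) (-((A : ℝ) + B + 1)) μ := by
    simpa using (hasDerivAt_id μ).const_mul (-((A : ℝ) + B + 1))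
  have h4 : HasDerivAt (fun μ : ℝ => 2 * μ * (1 + μ ^ 2)) (2 * (1 + μ ^ 2) + 2 * μ * (2 * μ)) μ := by
    have h5 : HasDerivAt (fun μ : ℝ => 2 * μ) 2 μ := by
      simpa using (hasDerivAt_id μ).const_mul (2 : ℝ)
    have h6 : HasDerivAt (fun μ : ℝ => 1 + μ ^ 2) (2 * μ) μ := by
      simpa using (hasDerivAt_pow 2 μ).const_add 1
    exact h5.mul h6
  convert! (hasDerivAt_one_add_sq_rpow (-((A : ℝ) + B + 1) / 2) μ).mul
    ((h3.mul h1).sub (h4.mul h2)) using 1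
  simp only [waveD, wave, Pi.sub_apply, Pi.mul_apply]
  have ode := hyperPoly_ode α A B (-μ ^ 2)
  generalize Polynomial.eval (-μ ^ 2) (hyperPoly α A B) = P at *
  generalize Polynomial.eval (-μ ^ 2) (Polynomial.derivative (hyperPoly α A B)) = P' at *
  generalize Polynomial.eval (-μ ^ 2)
    (Polynomial.derivative (Polynomial.derivative (hyperPoly α A B))) = P'' at *
  generalize (1 + μ ^ 2) ^ (-((A : ℝ) + B + 1) / 2) = W at *
  field_simp
  linear_combination (4 * W * (1 + μ ^ 2)) * ode

theorem solvesWave_zero (A B : ℕ) :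
    SolvesWave 0 ((A : ℝ) + B + 1) (((A : ℝ) - B) / (A + B + 1)) (wave 0 A B) (waveD 0 A B) := by
  intro μ hμ
  refine ⟨hasDerivAt_wave 0 A B μ, ?_⟩
  convert! hasDerivAt_waveD 0 A B hμ using 1
  have : (A : ℝ) + B + 1 ≠ 0 := by positivity
  field_simp
  push_cast
  ring

/-- Multiplication by μ lowers the friction coefficient from 3 to 1 and creates the term (1 + μ²)/μ²
of a Bessel equation of order one. The constant c is free by linearity; it later normalizes the
slope at 0. -/
theorem solvesWave_one (A B : ℕ) (c : ℝ) :
    SolvesWave 1 ((A : ℝ) + B + 1) (((A : ℝ) - B - 1) / (A + B + 1))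
      (fun μ => c * (μ * wave 1 A B μ))
      (fun μ => c * ((1 + μ ^ 2) * wave 1 A B μ + μ * waveD 1 A B μ)) := by
  intro μ hμ
  have hp : (1 + μ ^ 2) ≠ 0 := by positivity
  have h0 := hasDerivAt_id μ
  have h1 := hasDerivAt_wave 1 A B μ
  have h2 := hasDerivAt_waveD 1 A B hμ
  have h3 : HasDerivAt (fun μ : ℝ => 1 + μ ^ 2) (2 * μ) μ := by
    simpa using (hasDerivAt_pow 2 μ).const_add 1
  constructor
  · convert! (h0.mul h1).const_mul c using 1
    simp only [id]
    field_simp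
  · convert! ((h3.mul h1).add (h0.mul h2)).const_mul c using 1
    have : (A : ℝ) + B + 1 ≠ 0 := by positivity
    simp only [id]
    push_cast
    field_simp
    ring

open Filter Topology

theorem tendsto_wave (α A B : ℕ) :
    Tendsto (wave α A B) (𝓝[>] 0) (𝓝 (A.choose α : ℝ)) := by
  have h := (hasDerivAt_wave α A B 0).continuousAt.tendsto.mono_left
    (nhdsWithin_le_nhds (s := Set.Ioi 0))
  convert h using 2
  simp [wave, ← Polynomial.coeff_zero_eq_eval_zero, coeff_hyperPoly]

theorem tendsto_waveD (α A B : ℕ) :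
    Tendsto (waveD α A B) (𝓝[>] 0) (𝓝 0) := by
  have h : ContinuousAt (waveD α A B) 0 := by
    unfold waveD
    have h1 := (hasDerivAt_one_add_sq_rpow (-((A : ℝ) + B + 1) / 2) 0).continuousAt
    have h2 := (hasDerivAt_eval_neg_sq (hyperPoly α A B) 0).continuousAt
    have h3 := (hasDerivAt_eval_neg_sq (Polynomial.derivative (hyperPoly α A B)) 0).continuousAt
    fun_prop
  have h' := h.tendsto.mono_left (nhdsWithin_le_nhds (s := Set.Ioi 0))
  convert h' using 2
  simp [waveD]

/-! ### Explicit values at velocity 0 and μ = 1. -/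

/-- The squares of binomial coefficients, summed with alternating signs. -/
theorem eval_hyperPoly_zero_neg_one (N : ℕ) :
    (hyperPoly 0 N N).eval (-1) = if Even N then (-1) ^ (N / 2) * (N.choose (N / 2) : ℝ) else 0 := by
  -- The sum is the coefficient of X^N in (1 - X)^N (1 + X)^N = (1 - X²)^N.
  open Polynomial in
  have h1 : (hyperPoly 0 N N).eval (-1) = ((1 - X ^ 2 : ℝ[X]) ^ N).coeff N := by
    rw [show (1 - X ^ 2 : ℝ[X]) = (1 + -X) * (1 + X) by ring, mul_pow, Polynomial.coeff_mul,
      Finset.Nat.sum_antidiagonal_eq_sum_range_succ_mk]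
    simp only [hyperPoly, eval_finsetSum]
    refine Finset.sum_congr rfl fun r hr => ?_
    have h2 : ((1 + -X : ℝ[X]) ^ N).coeff r = (-1) ^ r * N.choose r := by
      have : (1 + -X : ℝ[X]) ^ N = ((1 + X) ^ N).comp (C (-1) * X) := by simp
      rw [this, comp_C_mul_X_coeff, coeff_one_add_X_pow]
      ring
    rw [h2, coeff_one_add_X_pow, Nat.choose_symm (by simpa [Nat.lt_succ_iff] using hr)]
    simp
    ring
  have h3 : ((1 - X ^ 2 : ℝ[X]) ^ N).coeff N =
     if Even N then (-1) ^ (N / 2) * (N.choose (N / 2) : ℝ) else 0 := by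
    have : (1 - X ^ 2 : ℝ[X]) ^ N = expand ℝ 2 (((1 + X) ^ N).comp (C (-1) * X)) := by
      simp [sub_eq_add_neg]
    rw [this, coeff_expand (by norm_num), comp_C_mul_X_coeff, coeff_one_add_X_pow]
    simp only [even_iff_two_dvd]
    split_ifs <;> ring
  rw [h1, h3]

/-- `√n` times the wave with `k = 0` at `μ = 1`. -/
theorem tendsto_wave_even :
    Tendsto (fun M : ℕ => √(4 * M + 1) * ((-1) ^ M * wave 0 (2 * M) (2 * M) 1)) atTop
      (𝓝 √(2 / Real.pi)) := by
  -- The square of the sequence is (4M + 1)/(4M + 2) divided by the Wallis product `W M`; this is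
  -- the first factor.
  have h0 : Tendsto (fun M : ℕ => 1 - (1 / 4 : ℝ) * (1 / ((M : ℝ) + 1 / 2))) atTop (𝓝 1) := by
    have : Tendsto (fun M : ℕ => 1 / ((M : ℝ) + 1 / 2)) atTop (𝓝 0) :=
      tendsto_const_nhds.div_atTop
        (tendsto_atTop_add_const_right _ _ tendsto_natCast_atTop_atTop)
    simpa using (this.const_mul (1 / 4 : ℝ)).const_sub 1
  have h := (Real.continuous_sqrt.tendsto _).comp
    ((Real.Wallis.tendsto_W_nhds_pi_div_two.inv₀ (by positivity)).mul h0)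
  rw [mul_one, inv_div] at h
  refine h.congr fun M => ?_
  have hw : (-1) ^ M * wave 0 (2 * M) (2 * M) 1 =
      2 ^ (-(4 * (M : ℝ) + 1) / 2) * ((2 * M).choose M : ℝ) := by
    have : ((-1 : ℝ) ^ M) * (-1) ^ M = 1 := by rw [← mul_pow]; simp
    rw [wave, one_pow, eval_hyperPoly_zero_neg_one, if_pos (even_two_mul M),
      Nat.mul_div_cancel_left M two_pos, show (1 + 1 : ℝ) = 2 by norm_num,
      show -(((2 * M : ℕ) : ℝ) + (2 * M : ℕ) + 1) / 2 = -(4 * (M : ℝ) + 1) / 2 by push_cast; ring]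
    linear_combination (2 ^ (-(4 * (M : ℝ) + 1) / 2) * ((2 * M).choose M : ℝ)) * this
  have hc : 0 < ((2 * M).choose M : ℝ) := by exact_mod_cast Nat.choose_pos (by omega)
  rw [hw, Function.comp_apply, Real.sqrt_eq_iff_mul_self_eq_of_pos (by positivity)]
  have h1 : (2 : ℝ) ^ (-(4 * (M : ℝ) + 1) / 2) * 2 ^ (-(4 * (M : ℝ) + 1) / 2) =
      (2 * 2 ^ (4 * M))⁻¹ := by
    rw [← Real.rpow_add two_pos, show -(4 * (M : ℝ) + 1) / 2 + -(4 * (M : ℝ) + 1) / 2 =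
      -((4 * M + 1 : ℕ) : ℝ) by push_cast; ring, Real.rpow_neg two_pos.le, Real.rpow_natCast]
    ring
  have h2 : ((2 * M).choose M : ℝ) = (2 * M).factorial / (M.factorial * M.factorial) := by
    rw [Nat.cast_choose ℝ (by omega : M ≤ 2 * M), two_mul, Nat.add_sub_cancel]
  have h3 : √(4 * (M : ℝ) + 1) * √(4 * (M : ℝ) + 1) = 4 * M + 1 :=
    Real.mul_self_sqrt (by positivity)
  calc _ = (√(4 * (M : ℝ) + 1) * √(4 * (M : ℝ) + 1)) *
        ((2 : ℝ) ^ (-(4 * (M : ℝ) + 1) / 2) * 2 ^ (-(4 * (M : ℝ) + 1) / 2)) *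
        ((2 * M).choose M * (2 * M).choose M) := by ring
    _ = _ := by
      rw [h1, h2, h3, Real.Wallis.W_eq_factorial_ratio]
      field_simp
      ring

theorem wave_odd (M : ℕ) : wave 0 (2 * M + 1) (2 * M + 1) 1 = 0 := by
  simp [wave, eval_hyperPoly_zero_neg_one]

/-! ### Bessel functions: derivatives and the bound by z^(-1/2). -/

/-- The Bessel function `J₀`. -/
noncomputable def besselJ₀ (z : ℝ) : ℝ :=
  (∫ t in (0 : ℝ)..Real.pi, Real.cos (z * Real.cos t)) / Real.pi

/-- The Bessel function `J₁`. -/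
noncomputable def besselJ₁ (z : ℝ) : ℝ :=
  (∫ t in (0 : ℝ)..Real.pi, Real.sin (z * Real.cos t) * Real.cos t) / Real.pi

theorem besselJ₀_zero : besselJ₀ 0 = 1 := by
  simp [besselJ₀, Real.pi_ne_zero]

theorem besselJ₁_zero : besselJ₁ 0 = 0 := by
  simp [besselJ₁]

theorem abs_integral_div_pi_le {f : ℝ → ℝ} (hf : ∀ t, |f t| ≤ 1) :
    |(∫ t in (0 : ℝ)..Real.pi, f t) / Real.pi| ≤ 1 := by
  have h := intervalIntegral.norm_integral_le_of_norm_le_const (a := 0) (b := Real.pi)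
    (f := f) (C := 1) fun t _ => hf t
  rw [sub_zero, one_mul, Real.norm_eq_abs, abs_of_pos Real.pi_pos] at h
  rw [abs_div, abs_of_pos Real.pi_pos]
  exact div_le_one_of_le₀ h Real.pi_pos.le

theorem abs_besselJ₀_le_one (z : ℝ) : |besselJ₀ z| ≤ 1 :=
  abs_integral_div_pi_le fun _ => Real.abs_cos_le_one _

theorem abs_besselJ₁_le_one (z : ℝ) : |besselJ₁ z| ≤ 1 :=
  abs_integral_div_pi_le fun t => by
    rw [abs_mul]
    exact mul_le_one₀ (Real.abs_sin_le_one _) (abs_nonneg _) (Real.abs_cos_le_one t)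

theorem hasDerivAt_integral_of_abs_le_one {F F' : ℝ → ℝ → ℝ} (hF : ∀ z, Continuous (F z))
    (hF' : ∀ z, Continuous (F' z)) (hb : ∀ z t, |F' z t| ≤ 1)
    (hd : ∀ z t, HasDerivAt (fun z => F z t) (F' z t) z) (z : ℝ) :
    HasDerivAt (fun z => (∫ t in (0 : ℝ)..Real.pi, F z t) / Real.pi)
      ((∫ t in (0 : ℝ)..Real.pi, F' z t) / Real.pi) z :=
  (intervalIntegral.hasDerivAt_integral_of_dominated_loc_of_deriv_le (F := F) (F' := F')
    (bound := fun _ => 1) Filter.univ_mem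
    (Filter.Eventually.of_forall fun z => (hF z).aestronglyMeasurable)
    ((hF z).intervalIntegrable _ _) (hF' z).aestronglyMeasurable
    (Filter.Eventually.of_forall fun t _ z _ => hb z t) intervalIntegrable_const
    (Filter.Eventually.of_forall fun t _ z _ => hd z t)).2.div_const _

theorem hasDerivAt_besselJ₀ (z : ℝ) : HasDerivAt besselJ₀ (-besselJ₁ z) z := by
  have h := hasDerivAt_integral_of_abs_le_one
    (F := fun z t => Real.cos (z * Real.cos t))
    (F' := fun z t => -(Real.sin (z * Real.cos t) * Real.cos t))
    (fun z => by fun_prop) (fun z => by fun_prop)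
    (fun z t => by
      rw [abs_neg, abs_mul]
      exact mul_le_one₀ (Real.abs_sin_le_one _) (abs_nonneg _) (Real.abs_cos_le_one t))
    (fun z t => by
      have := ((hasDerivAt_id z).mul_const (Real.cos t)).cos
      simpa using this) z
  convert! h using 1
  rw [besselJ₁, intervalIntegral.integral_neg, neg_div]

theorem hasDerivAt_besselJ₁_integral (z : ℝ) :
    HasDerivAt besselJ₁ ((∫ t in (0 : ℝ)..Real.pi,
      Real.cos (z * Real.cos t) * Real.cos t * Real.cos t) / Real.pi) z :=
  hasDerivAt_integral_of_abs_le_one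
    (F := fun z t => Real.sin (z * Real.cos t) * Real.cos t)
    (F' := fun z t => Real.cos (z * Real.cos t) * Real.cos t * Real.cos t)
    (fun z => by fun_prop) (fun z => by fun_prop)
    (fun z t => by
      rw [abs_mul, abs_mul]
      exact mul_le_one₀ (mul_le_one₀ (Real.abs_cos_le_one _) (abs_nonneg _)
        (Real.abs_cos_le_one t)) (abs_nonneg _) (Real.abs_cos_le_one t))
    (fun z t => by
      have := (((hasDerivAt_id z).mul_const (Real.cos t)).sin).mul_const (Real.cos t)
      simpa using this) z

theorem hasDerivAt_besselJ₁ {z : ℝ} (hz : z ≠ 0) :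
    HasDerivAt besselJ₁ (besselJ₀ z - besselJ₁ z / z) z := by
  have h := hasDerivAt_besselJ₁_integral z
  convert! h using 1
  -- Integration by parts: the integrand is the derivative of -sin(z cos t) sin t / z, which
  -- vanishes at 0 and π.
  have hp : ∫ t in (0 : ℝ)..Real.pi, (Real.cos (z * Real.cos t) * Real.sin t * Real.sin t -
      Real.sin (z * Real.cos t) * Real.cos t / z) = 0 := by
    have hd : ∀ t ∈ Set.uIcc 0 Real.pi, HasDerivAt
        (fun t => -(Real.sin (z * Real.cos t) * Real.sin t / z))
        (Real.cos (z * Real.cos t) * Real.sin t * Real.sin t -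
          Real.sin (z * Real.cos t) * Real.cos t / z) t := by
      intro t _
      convert! (((((Real.hasDerivAt_cos t).const_mul z).sin).mul
        (Real.hasDerivAt_sin t)).div_const z).neg using 1
      field_simp
      ring
    rw [intervalIntegral.integral_eq_sub_of_hasDerivAt hd
      (Continuous.intervalIntegrable (by fun_prop) _ _)]
    simp
  rw [besselJ₀, besselJ₁, div_right_comm, ← sub_div, ← intervalIntegral.integral_div,
    ← intervalIntegral.integral_sub
      (f := fun t => Real.cos (z * Real.cos t))
      (g := fun t => Real.sin (z * Real.cos t) * Real.cos t / z)
      (Continuous.intervalIntegrable (by fun_prop) _ _)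
      (Continuous.intervalIntegrable (by fun_prop) _ _)]
  congr 1
  rw [← sub_eq_zero, ← intervalIntegral.integral_sub
    (Continuous.intervalIntegrable (by fun_prop) _ _)
    (Continuous.intervalIntegrable (by fun_prop) _ _)]
  refine (intervalIntegral.integral_congr fun t _ => ?_).trans hp
  linear_combination (- Real.cos (z * Real.cos t)) * Real.sin_sq_add_cos_sq t

/-- `√z J₀(z)`. -/
noncomputable def sqrtJ₀ (z : ℝ) : ℝ := √z * besselJ₀ z

/-- `√z J₁(z)`. -/
noncomputable def sqrtJ₁ (z : ℝ) : ℝ := √z * besselJ₁ z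

theorem one_div_two_mul_sqrt {z : ℝ} (hz : 0 < z) : 1 / (2 * √z) = √z / (2 * z) := by
  have := Real.sqrt_pos.2 hz
  rw [div_eq_div_iff (by positivity) (by positivity)]
  linear_combination (-2 : ℝ) * Real.mul_self_sqrt hz.le

theorem hasDerivAt_sqrtJ₀ {z : ℝ} (hz : 0 < z) :
    HasDerivAt sqrtJ₀ (sqrtJ₀ z / (2 * z) - sqrtJ₁ z) z := by
  convert! (Real.hasDerivAt_sqrt hz.ne').mul (hasDerivAt_besselJ₀ z) using 1
  rw [sqrtJ₀, sqrtJ₁, one_div_two_mul_sqrt hz]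
  ring

theorem hasDerivAt_sqrtJ₁ {z : ℝ} (hz : 0 < z) :
    HasDerivAt sqrtJ₁ (sqrtJ₀ z - sqrtJ₁ z / (2 * z)) z := by
  convert! (Real.hasDerivAt_sqrt hz.ne').mul (hasDerivAt_besselJ₁ hz.ne') using 1
  rw [sqrtJ₀, sqrtJ₁, one_div_two_mul_sqrt hz]
  field_simp
  ring

theorem antitoneOn_Ici_of_hasDerivAt {f f' : ℝ → ℝ} {a : ℝ}
    (hf : ∀ z, a ≤ z → HasDerivAt f (f' z) z) (h : ∀ z, a ≤ z → f' z ≤ 0) :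
    AntitoneOn f (Set.Ici a) := by
  refine antitoneOn_of_deriv_nonpos (convex_Ici a)
    (fun z hz => (hf z hz).continuousAt.continuousWithinAt)
    (fun z hz => (hf z (interior_subset hz)).differentiableAt.differentiableWithinAt)
    fun z hz => ?_
  rw [(hf z (interior_subset hz)).deriv]
  exact h z (interior_subset hz)

theorem hasDerivAt_const_div (B : ℝ) {z : ℝ} (hz : z ≠ 0) :
    HasDerivAt (fun z => B / z) (-(B / z ^ 2)) z := by
  convert! (hasDerivAt_inv hz).const_mul B using 1
  field_simp

theorem abs_sub_le_of_abs_deriv_le {f f' : ℝ → ℝ} {B : ℝ}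
    (hf : ∀ z, 1 ≤ z → HasDerivAt f (f' z) z) (h : ∀ z, 1 ≤ z → |f' z| ≤ B / z ^ 2)
    {z w : ℝ} (hz : 1 ≤ z) (hw : z ≤ w) : |f z - f w| ≤ B / z := by
  have hB : 0 ≤ B := by simpa using (abs_nonneg _).trans (h 1 le_rfl)
  have h1 : AntitoneOn (fun z => f z + B / z) (Set.Ici 1) :=
    antitoneOn_Ici_of_hasDerivAt
      (fun z hz => (hf z hz).add (hasDerivAt_const_div B (by positivity)))
      fun z hz => by linarith [(abs_le.1 (h z hz)).2]
  have h2 : AntitoneOn (fun z => -f z + B / z) (Set.Ici 1) :=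
    antitoneOn_Ici_of_hasDerivAt
      (fun z hz => (hf z hz).neg.add (hasDerivAt_const_div B (by positivity)))
      fun z hz => by linarith [(abs_le.1 (h z hz)).1]
  have h3 := h1 (Set.mem_Ici.2 hz) (Set.mem_Ici.2 (hz.trans hw)) hw
  have h4 := h2 (Set.mem_Ici.2 hz) (Set.mem_Ici.2 (hz.trans hw)) hw
  have h5 : 0 ≤ B / w := div_nonneg hB (by linarith)
  simp only at h3 h4
  rw [abs_le]
  constructor <;> linarith

/-- For z ≥ 1, with u = √z J₀ and w = √z J₁, the correction -uw/z to the energy u² + w² removes the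
terms of order 1/z from its derivative and leaves uw/z². The corrected energy Q dominates both (u² +
w²)/2 and uw, so Q exp(1/z) decreases. For z ≤ 1 the bound |J| ≤ 1 suffices. -/
theorem sqrtJ_bounded : ∃ B : ℝ, 1 ≤ B ∧ ∀ z, 0 < z → |sqrtJ₀ z| ≤ B ∧ |sqrtJ₁ z| ≤ B := by
  have h1 : AntitoneOn (fun z => (sqrtJ₀ z ^ 2 + sqrtJ₁ z ^ 2 - sqrtJ₀ z * sqrtJ₁ z / z) *
      Real.exp (1 / z)) (Set.Ici 1) := by
    refine antitoneOn_Ici_of_hasDerivAt (f' := fun z => (sqrtJ₀ z * sqrtJ₁ z / z ^ 2 -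
      (sqrtJ₀ z ^ 2 + sqrtJ₁ z ^ 2 - sqrtJ₀ z * sqrtJ₁ z / z) / z ^ 2) * Real.exp (1 / z))
      (fun z hz => ?_) fun z hz => ?_
    · have hz : 0 < z := by linarith
      have d0 := hasDerivAt_sqrtJ₀ hz
      have d1 := hasDerivAt_sqrtJ₁ hz
      convert! (((d0.pow 2).add (d1.pow 2)).sub ((d0.mul d1).div (hasDerivAt_id z) hz.ne')).mul
        (hasDerivAt_const_div 1 hz.ne').exp using 1
      simp only [id, Pi.sub_apply, Pi.add_apply, Pi.pow_apply, Pi.mul_apply, Pi.div_apply]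
      field_simp
      ring
    · have hz0 : 0 < z := by linarith
      refine mul_nonpos_of_nonpos_of_nonneg ?_ (Real.exp_pos _).le
      rw [← sub_div]
      refine div_nonpos_of_nonpos_of_nonneg ?_ (by positivity)
      have : sqrtJ₀ z * sqrtJ₁ z / z ≤ (sqrtJ₀ z ^ 2 + sqrtJ₁ z ^ 2) / 2 := by
        rw [div_le_iff₀ hz0]
        nlinarith [sq_nonneg (sqrtJ₀ z - sqrtJ₁ z), sq_nonneg (sqrtJ₀ z), sq_nonneg (sqrtJ₁ z)]
      nlinarith [sq_nonneg (sqrtJ₀ z - sqrtJ₁ z)]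
  set D := (sqrtJ₀ 1 ^ 2 + sqrtJ₁ 1 ^ 2 - sqrtJ₀ 1 * sqrtJ₁ 1 / 1) * Real.exp (1 / 1) with hD
  refine ⟨max 1 (2 * D + 1), le_max_left _ _, fun z hz => ?_⟩
  rcases le_total z 1 with h | h
  · have hs : √z ≤ 1 := Real.sqrt_le_one.2 h
    constructor <;> refine le_trans ?_ (le_max_left _ _)
    · rw [sqrtJ₀, abs_mul, abs_of_nonneg (Real.sqrt_nonneg z)]
      exact mul_le_one₀ hs (abs_nonneg _) (abs_besselJ₀_le_one z)
    · rw [sqrtJ₁, abs_mul, abs_of_nonneg (Real.sqrt_nonneg z)]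
      exact mul_le_one₀ hs (abs_nonneg _) (abs_besselJ₁_le_one z)
  · have h2 := h1 (Set.mem_Ici.2 le_rfl) (Set.mem_Ici.2 h) h
    simp only [← hD] at h2
    have h3 : (sqrtJ₀ z ^ 2 + sqrtJ₁ z ^ 2) / 2 ≤
        sqrtJ₀ z ^ 2 + sqrtJ₁ z ^ 2 - sqrtJ₀ z * sqrtJ₁ z / z := by
      have : sqrtJ₀ z * sqrtJ₁ z / z ≤ (sqrtJ₀ z ^ 2 + sqrtJ₁ z ^ 2) / 2 := by
        rw [div_le_iff₀ hz]
        nlinarith [sq_nonneg (sqrtJ₀ z - sqrtJ₁ z), sq_nonneg (sqrtJ₀ z), sq_nonneg (sqrtJ₁ z)]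
      linarith
    have h4 : 1 ≤ Real.exp (1 / z) := Real.one_le_exp (by positivity)
    have h5 : sqrtJ₀ z ^ 2 + sqrtJ₁ z ^ 2 ≤ 2 * D := by
      nlinarith [sq_nonneg (sqrtJ₀ z), sq_nonneg (sqrtJ₁ z)]
    constructor <;> refine le_trans ?_ (le_max_right _ _) <;> rw [abs_le] <;> constructor <;>
      nlinarith [sq_nonneg (sqrtJ₀ z), sq_nonneg (sqrtJ₁ z), sq_nonneg (sqrtJ₀ z - 1),
        sq_nonneg (sqrtJ₀ z + 1), sq_nonneg (sqrtJ₁ z - 1), sq_nonneg (sqrtJ₁ z + 1)]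

/-! ### Convergence of the Bessel amplitudes. -/

/-- The component of `√z (J₀(z), J₁(z))` along `(cos z, sin z)`. -/
noncomputable def ampCos (z : ℝ) : ℝ := sqrtJ₀ z * Real.cos z + sqrtJ₁ z * Real.sin z

/-- The component of `√z (J₀(z), J₁(z))` along `(-sin z, cos z)`. -/
noncomputable def ampSin (z : ℝ) : ℝ := sqrtJ₁ z * Real.cos z - sqrtJ₀ z * Real.sin z

theorem sqrtJ₀_eq (z : ℝ) : sqrtJ₀ z = ampCos z * Real.cos z - ampSin z * Real.sin z := by
  rw [ampCos, ampSin]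
  linear_combination (-sqrtJ₀ z) * Real.sin_sq_add_cos_sq z

theorem sqrtJ₁_eq (z : ℝ) : sqrtJ₁ z = ampSin z * Real.cos z + ampCos z * Real.sin z := by
  rw [ampCos, ampSin]
  linear_combination (-sqrtJ₁ z) * Real.sin_sq_add_cos_sq z

theorem hasDerivAt_ampCos {z : ℝ} (hz : 0 < z) :
    HasDerivAt ampCos ((ampCos z * Real.cos (2 * z) - ampSin z * Real.sin (2 * z)) / (2 * z)) z := by
  convert! ((hasDerivAt_sqrtJ₀ hz).mul (Real.hasDerivAt_cos z)).add
    ((hasDerivAt_sqrtJ₁ hz).mul (Real.hasDerivAt_sin z)) using 1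
  rw [Real.cos_two_mul', Real.sin_two_mul, sqrtJ₀_eq, sqrtJ₁_eq]
  field_simp
  ring

theorem hasDerivAt_ampSin {z : ℝ} (hz : 0 < z) :
    HasDerivAt ampSin (-((ampSin z * Real.cos (2 * z) + ampCos z * Real.sin (2 * z)) / (2 * z)))
      z := by
  convert! ((hasDerivAt_sqrtJ₁ hz).mul (Real.hasDerivAt_cos z)).sub
    ((hasDerivAt_sqrtJ₀ hz).mul (Real.hasDerivAt_sin z)) using 1
  rw [Real.cos_two_mul', Real.sin_two_mul, sqrtJ₀_eq, sqrtJ₁_eq]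
  field_simp
  ring

theorem amp_bounded : ∃ B : ℝ, 1 ≤ B ∧ ∀ z, 0 < z → |ampCos z| ≤ B ∧ |ampSin z| ≤ B := by
  obtain ⟨B, hB, h⟩ := sqrtJ_bounded
  have key : ∀ a b z : ℝ, |a| ≤ B → |b| ≤ B →
      |a * Real.cos z| ≤ B ∧ |b * Real.sin z| ≤ B := by
    intro a b z ha hb
    rw [abs_mul, abs_mul]
    exact ⟨(mul_le_of_le_one_right (abs_nonneg _) (Real.abs_cos_le_one z)).trans ha,
      (mul_le_of_le_one_right (abs_nonneg _) (Real.abs_sin_le_one z)).trans hb⟩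
  refine ⟨2 * B, by linarith, fun z hz => ⟨?_, ?_⟩⟩
  · obtain ⟨h1, h2⟩ := key _ _ z (h z hz).1 (h z hz).2
    exact (abs_add_le _ _).trans (by linarith)
  · obtain ⟨h1, h2⟩ := key _ _ z (h z hz).2 (h z hz).1
    exact (abs_sub _ _).trans (by linarith)

theorem abs_mul_trig_le {a b B : ℝ} (ha : |a| ≤ B) (hb : |b| ≤ B) (z : ℝ) :
    |a * Real.sin z + b * Real.cos z| ≤ 2 * B ∧ |a * Real.cos z - b * Real.sin z| ≤ 2 * B := by
  have h : ∀ c s : ℝ, |c| ≤ B → |s| ≤ 1 → |c * s| ≤ B := fun c s hc hs => by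
    rw [abs_mul]
    exact (mul_le_of_le_one_right (abs_nonneg _) hs).trans hc
  have h1 := h a _ ha (Real.abs_sin_le_one z)
  have h2 := h b _ hb (Real.abs_cos_le_one z)
  have h3 := h a _ ha (Real.abs_cos_le_one z)
  have h4 := h b _ hb (Real.abs_sin_le_one z)
  exact ⟨(abs_add_le _ _).trans (by linarith), (abs_sub _ _).trans (by linarith)⟩

/-- The derivatives of the amplitudes are of size 1/z, but oscillate at frequency 2. Subtracting a
primitive of the oscillation, g/(4z), leaves a derivative of size 1/z², which integrates to O(1/z);
the subtracted terms are O(1/z) too. -/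
theorem amp_sub_le : ∃ B : ℝ, 1 ≤ B ∧ ∀ z w, 1 ≤ z → z ≤ w →
    |ampCos z - ampCos w| ≤ B / z ∧ |ampSin z - ampSin w| ≤ B / z := by
  obtain ⟨B, hB, h⟩ := amp_bounded
  have h2 : ∀ z : ℝ, HasDerivAt (fun z : ℝ => 2 * z) 2 z := fun z => by
    simpa using (hasDerivAt_id z).const_mul (2 : ℝ)
  have h4 : ∀ z : ℝ, HasDerivAt (fun z : ℝ => 4 * z) 4 z := fun z => by
    simpa using (hasDerivAt_id z).const_mul (4 : ℝ)
  have hc : ∀ z, 1 ≤ z → HasDerivAt (fun z => ampCos z -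
      (ampCos z * Real.sin (2 * z) + ampSin z * Real.cos (2 * z)) / (4 * z))
      ((ampSin z / 8 + (ampCos z * Real.sin (2 * z) + ampSin z * Real.cos (2 * z)) / 4) / z ^ 2)
      z := by
    intro z hz
    have hz : 0 < z := by linarith
    have d0 := hasDerivAt_ampCos hz
    have d1 := hasDerivAt_ampSin hz
    convert! d0.sub (((d0.mul (h2 z).sin).add (d1.mul (h2 z).cos)).div (h4 z) (by positivity))
      using 1
    simp only [Pi.add_apply, Pi.mul_apply]
    field_simp
    linear_combination (-(8 : ℝ) * ampSin z) * Real.sin_sq_add_cos_sq (2 * z)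
  have hs : ∀ z, 1 ≤ z → HasDerivAt (fun z => ampSin z -
      (ampCos z * Real.cos (2 * z) - ampSin z * Real.sin (2 * z)) / (4 * z))
      ((-ampCos z / 8 + (ampCos z * Real.cos (2 * z) - ampSin z * Real.sin (2 * z)) / 4) / z ^ 2)
      z := by
    intro z hz
    have hz : 0 < z := by linarith
    have d0 := hasDerivAt_ampCos hz
    have d1 := hasDerivAt_ampSin hz
    convert! d1.sub (((d0.mul (h2 z).cos).sub (d1.mul (h2 z).sin)).div (h4 z) (by positivity))
      using 1
    simp only [Pi.sub_apply, Pi.mul_apply]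
    field_simp
    linear_combination ((8 : ℝ) * ampCos z) * Real.sin_sq_add_cos_sq (2 * z)
  refine ⟨2 * B, by linarith, fun z w hz hw => ?_⟩
  have bd : ∀ {f : ℝ → ℝ} {g : ℝ → ℝ} {g' : ℝ → ℝ}, (∀ z, 1 ≤ z → |g z| ≤ 2 * B) →
      (∀ z, 1 ≤ z → HasDerivAt (fun z => f z - g z / (4 * z)) (g' z / z ^ 2) z) →
      (∀ z, 1 ≤ z → |g' z| ≤ B) → |f z - f w| ≤ 2 * B / z := by
    intro f g g' hg hd hg'
    have e1 := abs_sub_le_of_abs_deriv_le (B := B) hd (fun z hz => by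
      rw [abs_div, abs_of_pos (by positivity : 0 < z ^ 2)]
      exact div_le_div_of_nonneg_right (hg' z hz) (by positivity)) hz hw
    have e2 : ∀ y, z ≤ y → |g y / (4 * y)| ≤ B / z / 2 := fun y hy => by
      have hz0 : 0 < z := by linarith
      have hy0 : 0 < y := by linarith
      rw [abs_div, abs_of_pos (by positivity : 0 < 4 * y), div_div, div_le_div_iff₀ (by positivity)
        (by positivity)]
      nlinarith [hg y (hz.trans hy), abs_nonneg (g y)]
    have e3 := e2 z le_rfl
    have e4 := e2 w hw
    rw [show 2 * B / z = B / z + (B / z / 2 + B / z / 2) by ring]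
    calc |f z - f w| = |(f z - g z / (4 * z) - (f w - g w / (4 * w))) +
          (g z / (4 * z) - g w / (4 * w))| := by ring_nf
      _ ≤ _ := (abs_add_le _ _).trans (add_le_add e1 ((abs_sub _ _).trans (add_le_add e3 e4)))
  have hb : ∀ z, 1 ≤ z → |ampCos z| ≤ B ∧ |ampSin z| ≤ B := fun z hz => h z (by linarith)
  refine ⟨bd (fun z hz => (abs_mul_trig_le (hb z hz).1 (hb z hz).2 (2 * z)).1) hc
    fun z hz => ?_, bd (fun z hz => (abs_mul_trig_le (hb z hz).1 (hb z hz).2 (2 * z)).2) hs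
    fun z hz => ?_⟩
  · obtain ⟨h1, h2⟩ := hb z hz
    have h3 := (abs_mul_trig_le h1 h2 (2 * z)).1
    rw [abs_le] at *
    constructor <;> linarith
  · obtain ⟨h1, h2⟩ := hb z hz
    have h3 := (abs_mul_trig_le h1 h2 (2 * z)).2
    rw [abs_le] at *
    constructor <;> linarith

/-- At z = π/4 + Mπ and z = 3π/4 + Mπ the function √z J₀ sees only the difference, respectively the
sum, of the two amplitudes. Its limits along these two sequences therefore determine both amplitudes
at infinity. -/
theorem amp_asymp
    (h0 : Tendsto (fun M : ℕ => (-1) ^ M * sqrtJ₀ ((4 * M + 1) * Real.pi / 4)) atTop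
      (𝓝 √(2 / Real.pi)))
    (h1 : Tendsto (fun M : ℕ => (-1) ^ M * sqrtJ₀ ((4 * M + 3) * Real.pi / 4)) atTop (𝓝 0)) :
    ∃ B : ℝ, 1 ≤ B ∧ ∀ z, 1 ≤ z →
      |ampCos z - √(2 / Real.pi) * (√2 / 2)| ≤ B / z ∧
      |ampSin z + √(2 / Real.pi) * (√2 / 2)| ≤ B / z := by
  obtain ⟨B, hB, h⟩ := amp_sub_le
  have hs2 : √2 * √2 = (2 : ℝ) := Real.mul_self_sqrt (by norm_num)
  have hpow : ∀ M : ℕ, ((-1 : ℝ) ^ M) * (-1) ^ M = 1 := fun M => by rw [← mul_pow]; simp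
  have e0 : ∀ M : ℕ, ampCos ((4 * M + 1) * Real.pi / 4) - ampSin ((4 * M + 1) * Real.pi / 4) =
      √2 * ((-1) ^ M * sqrtJ₀ ((4 * M + 1) * Real.pi / 4)) := by
    intro M
    rw [sqrtJ₀_eq, show (4 * (M : ℝ) + 1) * Real.pi / 4 = Real.pi / 4 + M * Real.pi by ring,
      Real.cos_add_nat_mul_pi, Real.sin_add_nat_mul_pi, Real.cos_pi_div_four, Real.sin_pi_div_four]
    generalize ampCos _ = a
    generalize ampSin _ = b
    linear_combination (-(a - b) / 2 * ((-1 : ℝ) ^ M) * (-1) ^ M) * hs2 - (a - b) * hpow M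
  have e1 : ∀ M : ℕ, ampCos ((4 * M + 3) * Real.pi / 4) + ampSin ((4 * M + 3) * Real.pi / 4) =
      -√2 * ((-1) ^ M * sqrtJ₀ ((4 * M + 3) * Real.pi / 4)) := by
    intro M
    rw [sqrtJ₀_eq, show (4 * (M : ℝ) + 3) * Real.pi / 4 = Real.pi / 4 + Real.pi / 2 + M * Real.pi
      by ring, Real.cos_add_nat_mul_pi, Real.sin_add_nat_mul_pi, Real.cos_add_pi_div_two,
      Real.sin_add_pi_div_two, Real.cos_pi_div_four, Real.sin_pi_div_four]
    generalize ampCos _ = a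
    generalize ampSin _ = b
    linear_combination (-(a + b) / 2 * ((-1 : ℝ) ^ M) * (-1) ^ M) * hs2 - (a + b) * hpow M
  have hlarge : ∀ c z : ℝ, 0 ≤ c → ∀ᶠ M : ℕ in atTop, z ≤ (4 * M + c) * Real.pi / 4 := by
    intro c z hc
    filter_upwards [tendsto_natCast_atTop_atTop.eventually_ge_atTop z,
      tendsto_natCast_atTop_atTop.eventually_ge_atTop (0 : ℝ)] with M hM hM0
    nlinarith [Real.pi_gt_three]
  have d0 : ∀ z, 1 ≤ z → |ampCos z - ampSin z - √2 * √(2 / Real.pi)| ≤ 2 * (B / z) := by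
    intro z hz
    refine le_of_tendsto ((h0.const_mul √2).const_sub (ampCos z - ampSin z)).abs ?_
    filter_upwards [hlarge 1 z zero_le_one] with M hM
    rw [← e0]
    obtain ⟨a, b⟩ := h _ _ hz hM
    rw [abs_le] at *
    constructor <;> linarith
  have d1 : ∀ z, 1 ≤ z → |ampCos z + ampSin z| ≤ 2 * (B / z) := by
    intro z hz
    have := ((h1.const_mul (-√2)).const_sub (ampCos z + ampSin z)).abs
    rw [mul_zero, sub_zero] at this
    refine le_of_tendsto this ?_
    filter_upwards [hlarge 3 z (by norm_num)] with M hM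
    rw [← e1]
    obtain ⟨a, b⟩ := h _ _ hz hM
    rw [abs_le] at *
    constructor <;> linarith
  refine ⟨2 * B, by linarith, fun z hz => ?_⟩
  have a := d0 z hz
  have b := d1 z hz
  rw [mul_div_assoc]
  rw [abs_le] at a b
  rw [abs_le, abs_le]
  refine ⟨⟨?_, ?_⟩, ?_, ?_⟩ <;> linarith

theorem sqrtJ_asymp
    (h0 : Tendsto (fun M : ℕ => (-1) ^ M * sqrtJ₀ ((4 * M + 1) * Real.pi / 4)) atTop
      (𝓝 √(2 / Real.pi)))
    (h1 : Tendsto (fun M : ℕ => (-1) ^ M * sqrtJ₀ ((4 * M + 3) * Real.pi / 4)) atTop (𝓝 0)) :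
    ∃ B : ℝ, 1 ≤ B ∧ ∀ z, 0 < z →
      |sqrtJ₀ z - √(2 / Real.pi) * Real.sin (z + Real.pi / 4)| ≤ B / z ∧
      |sqrtJ₁ z + √(2 / Real.pi) * Real.cos (z + Real.pi / 4)| ≤ B / z := by
  obtain ⟨B, hB, h⟩ := amp_asymp h0 h1
  obtain ⟨B', hB', h'⟩ := sqrtJ_bounded
  refine ⟨2 * B + (B' + 1), by linarith, fun z hz => ?_⟩
  rcases le_total 1 z with hz1 | hz1
  · obtain ⟨a, b⟩ := h z hz1
    have hle : 2 * (B / z) ≤ (2 * B + (B' + 1)) / z := by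
      rw [← mul_div_assoc]
      gcongr
      linarith
    obtain ⟨i1, i2⟩ := abs_mul_trig_le a b z
    rw [Real.sin_add, Real.cos_add, Real.cos_pi_div_four, Real.sin_pi_div_four, sqrtJ₀_eq,
      sqrtJ₁_eq]
    constructor
    · refine le_trans (le_of_eq ?_) (i2.trans hle)
      congr 1; ring
    · refine le_trans (le_of_eq ?_) (i1.trans hle)
      congr 1; ring
  · obtain ⟨a, b⟩ := h' z hz
    have hs : √(2 / Real.pi) ≤ 1 := by
      rw [Real.sqrt_le_one, div_le_one Real.pi_pos]
      linarith [Real.pi_gt_three]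
    have hle : B' + 1 ≤ (2 * B + (B' + 1)) / z := by
      rw [le_div_iff₀ hz]
      nlinarith
    have key : ∀ x : ℝ, |x| ≤ 1 → |√(2 / Real.pi) * x| ≤ 1 := fun x hx => by
      rw [abs_mul, abs_of_nonneg (Real.sqrt_nonneg _)]
      exact mul_le_one₀ hs (abs_nonneg _) hx
    have i1 := key _ (Real.abs_sin_le_one (z + Real.pi / 4))
    have i2 := key _ (Real.abs_cos_le_one (z + Real.pi / 4))
    exact ⟨(abs_sub _ _).trans (by linarith), (abs_add_le _ _).trans (by linarith)⟩

/-! ### An energy inequality with an integrable singularity. -/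

/-- An energy estimate: `E = √(f² + g²)` with `E' ≤ a E + b / √μ` and `E(0+) = 0`. -/
theorem energy_le {f g f' g' : ℝ → ℝ} {a b M : ℝ} (hb : 0 ≤ b) (ha : 0 ≤ a) (hM : 0 < M)
    (hf : ∀ μ ∈ Set.Ioc 0 M, HasDerivAt f (f' μ) μ)
    (hg : ∀ μ ∈ Set.Ioc 0 M, HasDerivAt g (g' μ) μ)
    (h : ∀ μ ∈ Set.Ioc 0 M, f μ * f' μ + g μ * g' μ ≤
      √(f μ ^ 2 + g μ ^ 2) * (a * √(f μ ^ 2 + g μ ^ 2) + b / √μ))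
    (hf0 : Tendsto f (𝓝[>] 0) (𝓝 0)) (hg0 : Tendsto g (𝓝[>] 0) (𝓝 0)) :
    √(f M ^ 2 + g M ^ 2) ≤ Real.exp (a * M) * (2 * b * √M) := by
  have key : ∀ η : ℝ, 0 < η →
      √(f M ^ 2 + g M ^ 2) ≤ Real.exp (a * M) * (η + 2 * b * √M) := by
    intro η hη
    -- The term η² keeps the norm differentiable where f and g both vanish; η is sent to 0 at the
    -- end.
    set E : ℝ → ℝ := fun μ => √(f μ ^ 2 + g μ ^ 2 + η ^ 2) with hE
    have hpos : ∀ μ, 0 < f μ ^ 2 + g μ ^ 2 + η ^ 2 := fun μ => by positivity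
    have hEpos : ∀ μ, 0 < E μ := fun μ => Real.sqrt_pos.2 (hpos μ)
    have hNE : ∀ μ, √(f μ ^ 2 + g μ ^ 2) ≤ E μ := fun μ =>
      Real.sqrt_le_sqrt (by linarith [sq_nonneg η])
    set G : ℝ → ℝ := fun μ => E μ * Real.exp (-(a * μ)) - 2 * b * √μ with hG
    have hGd : ∀ μ ∈ Set.Ioc 0 M, HasDerivAt G
        (((f μ * f' μ + g μ * g' μ) / E μ - a * E μ) * Real.exp (-(a * μ)) - b / √μ) μ := by
      intro μ hμ
      have h0 : 0 < √μ := Real.sqrt_pos.2 hμ.1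
      have hl : HasDerivAt (fun μ => -(a * μ)) (-a) μ := by
        simpa using (hasDerivAt_id μ).const_mul (-a)
      have hN : HasDerivAt (fun μ => f μ ^ 2 + g μ ^ 2 + η ^ 2)
          (2 * (f μ * f' μ + g μ * g' μ)) μ := by
        convert! ((((hf μ hμ).pow 2).add ((hg μ hμ).pow 2)).add_const (η ^ 2)) using 1
        push_cast
        ring
      convert! (((hN.sqrt (hpos μ).ne').mul hl.exp).sub
        ((Real.hasDerivAt_sqrt hμ.1.ne').const_mul (2 * b))) using 1
      have := hEpos μ
      simp only [hE] at this ⊢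
      field_simp
      ring
    have hanti : AntitoneOn G (Set.Ioc 0 M) := by
      refine antitoneOn_of_deriv_nonpos (convex_Ioc 0 M)
        (fun μ hμ => (hGd μ hμ).continuousAt.continuousWithinAt)
        (fun μ hμ => (hGd μ (interior_subset hμ)).differentiableAt.differentiableWithinAt)
        fun μ hμ => ?_
      have hμ := interior_subset hμ
      rw [(hGd μ hμ).deriv]
      have h0 : 0 < √μ := Real.sqrt_pos.2 hμ.1
      have h1 : (f μ * f' μ + g μ * g' μ) / E μ - a * E μ ≤ b / √μ := by
        rw [sub_le_iff_le_add, div_le_iff₀ (hEpos μ)]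
        refine (h μ hμ).trans ?_
        have h2 : 0 ≤ b / √μ := by positivity
        have h3 := hNE μ
        have h4 : 0 ≤ √(f μ ^ 2 + g μ ^ 2) := Real.sqrt_nonneg _
        rw [mul_comm]
        refine mul_le_mul ?_ h3 h4 (add_nonneg h2 (mul_nonneg ha (hEpos μ).le))
        nlinarith
      have h2 : Real.exp (-(a * μ)) ≤ 1 := Real.exp_le_one_iff.2 (by nlinarith [hμ.1])
      have h3 := mul_le_mul_of_nonneg_right h1 (Real.exp_pos (-(a * μ))).le
      have h4 : b / √μ * Real.exp (-(a * μ)) ≤ b / √μ :=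
        mul_le_of_le_one_right (by positivity) h2
      linarith
    have hlim : Tendsto G (𝓝[>] 0) (𝓝 η) := by
      have e1 : Tendsto E (𝓝[>] 0) (𝓝 η) := by
        have := ((hf0.pow 2).add (hg0.pow 2)).add_const (η ^ 2) |>.sqrt
        simpa [Real.sqrt_sq hη.le] using this
      have e2 : Tendsto (fun μ : ℝ => Real.exp (-(a * μ))) (𝓝[>] 0) (𝓝 1) := by
        have : ContinuousAt (fun μ : ℝ => Real.exp (-(a * μ))) 0 := by fun_prop
        simpa using this.tendsto.mono_left (nhdsWithin_le_nhds (s := Set.Ioi 0))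
      have e3 : Tendsto (fun μ : ℝ => 2 * b * √μ) (𝓝[>] 0) (𝓝 0) := by
        have : ContinuousAt (fun μ : ℝ => 2 * b * √μ) 0 := by fun_prop
        simpa using this.tendsto.mono_left (nhdsWithin_le_nhds (s := Set.Ioi 0))
      simpa using (e1.mul e2).sub e3
    have hle : G M ≤ η := by
      refine ge_of_tendsto hlim ?_
      filter_upwards [Ioc_mem_nhdsGT hM] with s hs
      exact hanti hs ⟨hM, le_rfl⟩ hs.2
    have h5 : E M * Real.exp (-(a * M)) ≤ η + 2 * b * √M := by
      simp only [hG] at hle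
      linarith
    refine (hNE M).trans ?_
    have h6 := mul_le_mul_of_nonneg_left h5 (Real.exp_pos (a * M)).le
    rwa [mul_left_comm, ← Real.exp_add, add_neg_cancel, Real.exp_zero, mul_one] at h6
  refine le_of_forall_pos_le_add fun e he => ?_
  refine (key (e / Real.exp (a * M)) (by positivity)).trans (le_of_eq ?_)
  field_simp
  ring

/-! ### Rate and phase. -/

/-- The derivative of the phase per unit time with respect to `arctan μ`, at velocity `v`. -/
noncomputable def rate (v μ : ℝ) : ℝ := √(1 - v ^ 2 * (1 + μ ^ 2))

/-- The phase per unit time at velocity `v`. -/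
noncomputable def phase (v μ : ℝ) : ℝ :=
  Real.arcsin (μ / √((1 + μ ^ 2) * (1 - v ^ 2))) - v * Real.arcsin (v * μ / √(1 - v ^ 2))

theorem phase_zero (v : ℝ) : phase v 0 = 0 := by simp [phase]

theorem rate_sq {v μ : ℝ} (h : v ^ 2 * (1 + μ ^ 2) < 1) :
    rate v μ ^ 2 = 1 - v ^ 2 * (1 + μ ^ 2) := Real.sq_sqrt (by linarith)

theorem rate_pos {v μ : ℝ} (h : v ^ 2 * (1 + μ ^ 2) < 1) : 0 < rate v μ :=
  Real.sqrt_pos.2 (by linarith)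

theorem hasDerivAt_one_add_sq (μ : ℝ) : HasDerivAt (fun μ : ℝ => 1 + μ ^ 2) (2 * μ) μ := by
  simpa using (hasDerivAt_pow 2 μ).const_add 1

theorem hasDerivAt_rate {v μ : ℝ} (h : v ^ 2 * (1 + μ ^ 2) < 1) :
    HasDerivAt (rate v) (-(v ^ 2 * μ / rate v μ)) μ := by
  have h1 : (1 - v ^ 2 * (1 + μ ^ 2)) ≠ 0 := by linarith
  convert! (((hasDerivAt_one_add_sq μ).const_mul (v ^ 2)).const_sub 1).sqrt h1 using 1
  have := rate_pos h
  rw [rate] at *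
  field_simp

theorem hasDerivAt_phase {v μ : ℝ} (h : v ^ 2 * (1 + μ ^ 2) < 1) :
    HasDerivAt (phase v) (rate v μ / (1 + μ ^ 2)) μ := by
  have hp : 0 < 1 + μ ^ 2 := by positivity
  have hv : 0 < 1 - v ^ 2 := by nlinarith [sq_nonneg (v * μ)]
  have hr := rate_sq h
  have hr0 := rate_pos h
  set R := rate v μ with hR
  set s := √(1 - v ^ 2) with hs
  have hs0 : 0 < s := Real.sqrt_pos.2 hv
  have hs2 : s ^ 2 = 1 - v ^ 2 := Real.sq_sqrt hv.le
  set q := √(1 + μ ^ 2) with hq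
  have hq0 : 0 < q := Real.sqrt_pos.2 hp
  have hq2 : q ^ 2 = 1 + μ ^ 2 := Real.sq_sqrt hp.le
  -- This identifies the cosines of the two arcsines as R/(qs) and R/s, so the derivatives combine
  -- to (1 - v²q²)/(q²R) = R/q².
  have habs : ∀ x y : ℝ, 0 < y → 1 - x ^ 2 = y ^ 2 → x ≠ -1 ∧ x ≠ 1 ∧ √(1 - x ^ 2) = y := by
    intro x y hy hxy
    refine ⟨?_, ?_, by rw [hxy, Real.sqrt_sq hy.le]⟩ <;> rintro rfl <;> nlinarith
  obtain ⟨a1, a2, a3⟩ := habs (μ / (q * s)) (R / (q * s)) (by positivity) (by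
    field_simp
    rw [hr, hq2, hs2]
    ring)
  obtain ⟨b1, b2, b3⟩ := habs (v * μ / s) (R / s) (by positivity) (by
    field_simp
    rw [hr, hs2]
    ring)
  have d1 : HasDerivAt (fun μ : ℝ => μ / (√(1 + μ ^ 2) * s)) (1 / (q ^ 3 * s)) μ := by
    convert! (hasDerivAt_id μ).div (((hasDerivAt_one_add_sq μ).sqrt hp.ne').mul_const s)
      (by positivity) using 1
    simp only [id, ← hq]
    field_simp
    linear_combination -hq2
  have d2 : HasDerivAt (fun μ : ℝ => v * μ / s) (v / s) μ := by
    simpa using ((hasDerivAt_id μ).const_mul v).div_const s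
  have e : phase v = fun μ => Real.arcsin (μ / (√(1 + μ ^ 2) * s)) -
      v * Real.arcsin (v * μ / s) := by
    funext μ
    rw [phase, Real.sqrt_mul (by positivity)]
  rw [e]
  convert! ((Real.hasDerivAt_arcsin a1 a2).comp μ d1).sub
    (((Real.hasDerivAt_arcsin b1 b2).comp μ d2).const_mul v) using 1
  rw [a3, b3]
  field_simp
  rw [hr, hq2]
  ring

theorem le_of_hasDerivAt_le {f g f' g' : ℝ → ℝ} {M : ℝ} (hM : 0 ≤ M)
    (hf : ∀ μ ∈ Set.Icc 0 M, HasDerivAt f (f' μ) μ) (hg : ∀ μ ∈ Set.Icc 0 M, HasDerivAt g (g' μ) μ)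
    (h : ∀ μ ∈ Set.Icc 0 M, f' μ ≤ g' μ) (h0 : f 0 = g 0) : f M ≤ g M := by
  have hd : ∀ μ ∈ Set.Icc 0 M, HasDerivAt (fun μ => f μ - g μ) (f' μ - g' μ) μ :=
    fun μ hμ => (hf μ hμ).sub (hg μ hμ)
  have := antitoneOn_of_deriv_nonpos (convex_Icc 0 M)
    (fun μ hμ => (hd μ hμ).continuousAt.continuousWithinAt)
    (fun μ hμ => (hd μ (interior_subset hμ)).differentiableAt.differentiableWithinAt)
    (fun μ hμ => by
      rw [(hd μ (interior_subset hμ)).deriv]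
      linarith [h μ (interior_subset hμ)])
    (Set.left_mem_Icc.2 hM) (Set.right_mem_Icc.2 hM) hM
  simp only [h0, sub_self] at this
  linarith

theorem sq_mul_mono {v μ s c : ℝ} (h : v ^ 2 * (1 + μ ^ 2) ≤ c) (hs : 0 ≤ s) (hsμ : s ≤ μ) :
    v ^ 2 * (1 + s ^ 2) ≤ c := by
  refine le_trans ?_ h
  gcongr

theorem le_rate {v μ d : ℝ} (h : v ^ 2 * (1 + μ ^ 2) ≤ 1 - d ^ 2) :
    d ≤ rate v μ := by
  rw [rate]
  exact Real.le_sqrt_of_sq_le (by linarith)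

theorem rate_le_one (v μ : ℝ) : rate v μ ≤ 1 := by
  rw [rate, Real.sqrt_le_one]
  have : 0 ≤ v ^ 2 * (1 + μ ^ 2) := by positivity
  linarith

/-- The cubic bound holds because differentiating μ · rate - phase cancels the terms of order zero
in μ and leaves μ² times a bounded factor. It is what makes `phaseDev` bounded at 0. -/
theorem phase_bounds {v μ d : ℝ} (hd : 0 < d) (hμ : 0 ≤ μ) (hμ1 : μ ≤ 1)
    (h : v ^ 2 * (1 + μ ^ 2) ≤ 1 - d ^ 2) :
    d * μ / 2 ≤ phase v μ ∧ phase v μ ≤ μ ∧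
      |μ * rate v μ - phase v μ| ≤ (1 + 1 / d) * μ ^ 3 := by
  have hs : ∀ s ∈ Set.Icc 0 μ, v ^ 2 * (1 + s ^ 2) ≤ 1 - d ^ 2 := fun s hs =>
    sq_mul_mono h hs.1 hs.2
  have hs' : ∀ s ∈ Set.Icc 0 μ, v ^ 2 * (1 + s ^ 2) < 1 := fun s hs' => by
    nlinarith [hs s hs']
  have hP : ∀ s ∈ Set.Icc 0 μ, HasDerivAt (phase v) (rate v s / (1 + s ^ 2)) s := fun s hs =>
    hasDerivAt_phase (hs' s hs)
  have hlin : ∀ c : ℝ, ∀ s ∈ Set.Icc 0 μ, HasDerivAt (fun s => c * s) c s := fun c s _ => by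
    simpa using (hasDerivAt_id s).const_mul c
  have hcub : ∀ c : ℝ, ∀ s ∈ Set.Icc 0 μ, HasDerivAt (fun s => c * s ^ 3) (c * (3 * s ^ 2)) s :=
    fun c s _ => by simpa using (hasDerivAt_pow 3 s).const_mul c
  have hD : ∀ s ∈ Set.Icc 0 μ, HasDerivAt (fun s => s * rate v s - phase v s)
      (s ^ 2 * (rate v s / (1 + s ^ 2) - v ^ 2 / rate v s)) s := fun s hs => by
    have := rate_pos (hs' s hs)
    convert! ((hasDerivAt_id s).mul (hasDerivAt_rate (hs' s hs))).sub (hP s hs) using 1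
    simp only [id]
    field_simp
    ring
  have hDb : ∀ s ∈ Set.Icc 0 μ,
      |s ^ 2 * (rate v s / (1 + s ^ 2) - v ^ 2 / rate v s)| ≤ (1 + 1 / d) * (3 * s ^ 2) := by
    intro s hs1
    have h1 := le_rate (hs s hs1)
    have h2 := rate_pos (hs' s hs1)
    have h3 : rate v s / (1 + s ^ 2) ≤ 1 := by
      rw [div_le_one (by positivity)]
      nlinarith [rate_le_one v s, sq_nonneg s]
    have h4 : v ^ 2 / rate v s ≤ 1 / d := by
      refine div_le_div₀ zero_le_one ?_ hd h1
      nlinarith [hs' s hs1, sq_nonneg (v * s)]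
    have h5 : 0 ≤ rate v s / (1 + s ^ 2) := by positivity
    have h6 : 0 ≤ v ^ 2 / rate v s := by positivity
    rw [abs_mul, abs_of_nonneg (sq_nonneg s)]
    have h7 : |rate v s / (1 + s ^ 2) - v ^ 2 / rate v s| ≤ 1 + 1 / d := by
      rw [abs_le]
      constructor <;> linarith
    have h8 : 0 < 1 / d := by positivity
    nlinarith [sq_nonneg s]
  refine ⟨?_, ?_, ?_⟩
  · have := le_of_hasDerivAt_le hμ (hlin (d / 2)) hP (fun s hs1 => by
      rw [le_div_iff₀ (by positivity)]
      have := le_rate (hs s hs1)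
      have h1 : s ^ 2 ≤ 1 := pow_le_one₀ hs1.1 (hs1.2.trans hμ1)
      nlinarith) (by simp [phase_zero])
    linarith
  · have := le_of_hasDerivAt_le hμ hP (hlin 1) (fun s hs1 => by
      rw [div_le_one (by positivity)]
      nlinarith [rate_le_one v s, sq_nonneg s]) (by simp [phase_zero])
    linarith
  · rw [abs_le]
    constructor
    · have := le_of_hasDerivAt_le hμ (hcub (-(1 + 1 / d))) hD (fun s hs1 => by
        linarith [(abs_le.1 (hDb s hs1)).1]) (by simp [phase_zero])
      linarith
    · exact le_of_hasDerivAt_le hμ hD (hcub (1 + 1 / d)) (fun s hs1 =>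
        (abs_le.1 (hDb s hs1)).2) (by simp [phase_zero])

/-! ### The Liouville–Green transformation and its defect. -/

/-- `√(μ h / H)` for the rate `h` and the phase `H`. -/
noncomputable def gain (v μ : ℝ) : ℝ := √(μ * rate v μ / phase v μ)

/-- The logarithmic derivative of `gain` with respect to `arctan μ`. -/
noncomputable def gainLog (v μ : ℝ) : ℝ :=
  (-(v ^ 2 * μ * (1 + μ ^ 2) / rate v μ ^ 2) + (1 + μ ^ 2) / μ - rate v μ / phase v μ) / 2

/-- The derivative of `gainLog` with respect to `arctan μ`. -/
noncomputable def gainLogD (v μ : ℝ) : ℝ :=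
  ((1 + μ ^ 2) * (-(v ^ 2 * (1 + 3 * μ ^ 2) / rate v μ ^ 2) -
    2 * v ^ 4 * μ ^ 2 * (1 + μ ^ 2) / rate v μ ^ 4 + (1 - 1 / μ ^ 2) +
    v ^ 2 * μ / (rate v μ * phase v μ)) + rate v μ ^ 2 / phase v μ ^ 2) / 2

/-- The perturbation of the Bessel equation of order `0`. -/
noncomputable def defect (v μ : ℝ) : ℝ :=
  (1 + μ ^ 2) - gainLogD v μ + gainLog v μ ^ 2 - gainLog v μ * ((1 + μ ^ 2) / μ)

theorem phase_pos {v μ : ℝ} (hμ : 0 < μ) (hμ1 : μ ≤ 1) (h : v ^ 2 * (1 + μ ^ 2) < 1) :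
    0 < phase v μ := by
  -- The best admissible d is the rate at μ itself.
  have h1 := (phase_bounds (v := v) (d := rate v μ) (rate_pos h) hμ.le hμ1 (by rw [rate_sq h]; linarith)).1
  have := rate_pos h
  exact lt_of_lt_of_le (by positivity) h1

theorem hasDerivAt_gain {v μ : ℝ} (hμ : 0 < μ) (hμ1 : μ ≤ 1) (h : v ^ 2 * (1 + μ ^ 2) < 1) :
    HasDerivAt (gain v) (gainLog v μ * gain v μ / (1 + μ ^ 2)) μ := by
  have hh := rate_pos h
  have hH := phase_pos hμ hμ1 h
  have hq : 0 < μ * rate v μ / phase v μ := by positivity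
  convert! (((hasDerivAt_id μ).mul (hasDerivAt_rate h)).div (hasDerivAt_phase h) hH.ne').sqrt
    hq.ne' using 1
  have h0 : 0 < gain v μ := Real.sqrt_pos.2 hq
  have h2 : gain v μ ^ 2 = μ * rate v μ / phase v μ := Real.sq_sqrt hq.le
  have h3 : √(μ * rate v μ / phase v μ) = gain v μ := rfl
  simp only [id, Pi.mul_apply, Pi.div_apply, h3]
  rw [eq_div_iff (by positivity)]
  calc _ = gainLog v μ * gain v μ ^ 2 * (2 / (1 + μ ^ 2)) := by ring
    _ = _ := by
      rw [h2, gainLog]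
      field_simp
      ring

theorem hasDerivAt_gainLog {v μ : ℝ} (hμ : 0 < μ) (hμ1 : μ ≤ 1) (h : v ^ 2 * (1 + μ ^ 2) < 1) :
    HasDerivAt (gainLog v) (gainLogD v μ / (1 + μ ^ 2)) μ := by
  have hh := rate_pos h
  have hH := phase_pos hμ hμ1 h
  have h1 := hasDerivAt_one_add_sq μ
  have d1 := (((hasDerivAt_id μ).const_mul (v ^ 2)).mul h1).div ((hasDerivAt_rate h).pow 2)
    (pow_ne_zero 2 hh.ne')
  have d2 := h1.div (hasDerivAt_id μ) hμ.ne'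
  have d3 := (hasDerivAt_rate h).div (hasDerivAt_phase h) hH.ne'
  convert! ((d1.neg.add d2).sub d3).div_const 2 using 1
  simp only [id, Pi.mul_apply, Pi.pow_apply]
  rw [gainLogD]
  field_simp
  ring

/-- The relative deviation of the phase from a linear function. -/
noncomputable def phaseDev (v μ : ℝ) : ℝ := (μ * rate v μ - phase v μ) / (μ ^ 2 * phase v μ)

/-- This isolates the simple pole at μ = 0; once substituted, all negative powers of μ in `gainLog`
and `gainLogD` cancel. -/
theorem rate_div_phase {v μ : ℝ} (hμ : 0 < μ) (hH : 0 < phase v μ) :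
    rate v μ / phase v μ = 1 / μ + phaseDev v μ * μ := by
  rw [phaseDev]
  field_simp
  ring

theorem gainLog_eq {v μ : ℝ} (hμ : 0 < μ) (hH : 0 < phase v μ) :
    gainLog v μ = μ * ((1 - v ^ 2 * (1 + μ ^ 2) * (1 / rate v μ) ^ 2 - phaseDev v μ) / 2) := by
  rw [gainLog, rate_div_phase hμ hH]
  field_simp
  ring

theorem gainLogD_eq {v μ : ℝ} (hμ : 0 < μ) (hH : 0 < phase v μ) :
    gainLogD v μ = ((1 + μ ^ 2) * (-(v ^ 2 * (1 + 3 * μ ^ 2) * (1 / rate v μ) ^ 2) -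
      2 * v ^ 4 * μ ^ 2 * (1 + μ ^ 2) * (1 / rate v μ) ^ 4 + 1 +
      v ^ 2 * (1 / rate v μ) * (μ / phase v μ)) + 2 * phaseDev v μ + phaseDev v μ ^ 2 * μ ^ 2 - 1)
      / 2 := by
  rw [gainLogD, ← div_pow, rate_div_phase hμ hH]
  field_simp
  ring

/-- With the poles cancelled, each quantity is a polynomial (for `gainLog`, μ times one) in μ, v,
1/rate, `phaseDev` and μ/phase. These five arguments stay in a ball depending only on d, so
compactness gives the constant. -/
theorem gain_estimates {d : ℝ} (hd : 0 < d) : ∃ K : ℝ, 1 ≤ K ∧ ∀ v μ : ℝ, 0 < μ → μ ≤ 1 →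
    v ^ 2 * (1 + μ ^ 2) ≤ 1 - d ^ 2 → |gainLog v μ| ≤ K * μ ∧ |phaseDev v μ| ≤ K ∧
      |defect v μ| ≤ K ∧ |(1 + μ ^ 2) / μ ^ 2 - (rate v μ / phase v μ) ^ 2 - defect v μ| ≤ K := by
  set P : ℝ × ℝ × ℝ × ℝ × ℝ → ℝ := fun p =>
    (1 - p.2.1 ^ 2 * (1 + p.1 ^ 2) * p.2.2.1 ^ 2 - p.2.2.2.1) / 2 with hP
  set Q : ℝ × ℝ × ℝ × ℝ × ℝ → ℝ := fun p => ((1 + p.1 ^ 2) *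
    (-(p.2.1 ^ 2 * (1 + 3 * p.1 ^ 2) * p.2.2.1 ^ 2) -
      2 * p.2.1 ^ 4 * p.1 ^ 2 * (1 + p.1 ^ 2) * p.2.2.1 ^ 4 + 1 +
      p.2.1 ^ 2 * p.2.2.1 * p.2.2.2.2) + 2 * p.2.2.2.1 + p.2.2.2.1 ^ 2 * p.1 ^ 2 - 1) / 2 with hQ
  set S : ℝ × ℝ × ℝ × ℝ × ℝ → ℝ := fun p => (1 + p.1 ^ 2) - Q p + (p.1 * P p) ^ 2 -
    P p * (1 + p.1 ^ 2) with hS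
  set T : ℝ × ℝ × ℝ × ℝ × ℝ → ℝ := fun p =>
    1 - 2 * p.2.2.2.1 - p.2.2.2.1 ^ 2 * p.1 ^ 2 - S p with hT
  set R : ℝ := 1 + 1 / d + 2 / d + (1 + 1 / d) * (2 / d) with hR
  have hd1 : 0 < 1 / d := by positivity
  have hd2 : 0 < 2 / d := by positivity
  have hd3 : 0 < (1 + 1 / d) * (2 / d) := by positivity
  obtain ⟨C1, h1⟩ := (isCompact_closedBall (0 : ℝ × ℝ × ℝ × ℝ × ℝ) R).exists_bound_of_continuousOn
    (f := P) (Continuous.continuousOn (by fun_prop))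
  obtain ⟨C2, h2⟩ := (isCompact_closedBall (0 : ℝ × ℝ × ℝ × ℝ × ℝ) R).exists_bound_of_continuousOn
    (f := S) (Continuous.continuousOn (by fun_prop))
  obtain ⟨C3, h3⟩ := (isCompact_closedBall (0 : ℝ × ℝ × ℝ × ℝ × ℝ) R).exists_bound_of_continuousOn
    (f := T) (Continuous.continuousOn (by fun_prop))
  refine ⟨1 + R + |C1| + |C2| + |C3|, ?_, fun v μ hμ hμ1 h => ?_⟩
  · have := abs_nonneg C1
    have := abs_nonneg C2
    have := abs_nonneg C3
    linarith
  have h' : v ^ 2 * (1 + μ ^ 2) < 1 := by nlinarith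
  have hh := rate_pos h'
  have hH := phase_pos hμ hμ1 h'
  obtain ⟨b1, b2, b3⟩ := phase_bounds hd hμ.le hμ1 h
  have hv : |v| ≤ 1 := by
    rw [abs_le_one_iff_mul_self_le_one]
    nlinarith [sq_nonneg (v * μ)]
  have hrate : |1 / rate v μ| ≤ 1 / d := by
    rw [abs_of_pos (by positivity)]
    exact one_div_le_one_div_of_le hd (le_rate h)
  have hkap : |μ / phase v μ| ≤ 2 / d := by
    rw [abs_of_pos (by positivity), div_le_div_iff₀ hH hd]
    linarith
  have hdev : |phaseDev v μ| ≤ (1 + 1 / d) * (2 / d) := by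
    rw [phaseDev, abs_div, abs_of_pos (by positivity : 0 < μ ^ 2 * phase v μ),
      div_le_iff₀ (by positivity)]
    refine b3.trans ?_
    have : μ ≤ 2 / d * phase v μ := by
      rw [div_mul_eq_mul_div, le_div_iff₀ hd]
      linarith
    calc (1 + 1 / d) * μ ^ 3 = (1 + 1 / d) * μ ^ 2 * μ := by ring
      _ ≤ (1 + 1 / d) * μ ^ 2 * (2 / d * phase v μ) := by gcongr
      _ = _ := by ring
  set p : ℝ × ℝ × ℝ × ℝ × ℝ := (μ, v, 1 / rate v μ, phaseDev v μ, μ / phase v μ) with hp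
  have hmem : p ∈ Metric.closedBall (0 : ℝ × ℝ × ℝ × ℝ × ℝ) R := by
    rw [mem_closedBall_zero_iff]
    simp only [hp, Prod.norm_def, Real.norm_eq_abs, sup_le_iff]
    rw [abs_of_pos hμ]
    refine ⟨?_, ?_, ?_, ?_, ?_⟩ <;> linarith
  have e1 : gainLog v μ = μ * P p := gainLog_eq hμ hH
  have e2 : defect v μ = S p := by
    have q1 : gainLogD v μ = Q p := gainLogD_eq hμ hH
    have q2 : S p = (1 + μ ^ 2) - Q p + (μ * P p) ^ 2 - P p * (1 + μ ^ 2) := rfl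
    rw [defect, q1, q2, e1]
    field_simp
  have e3 : (1 + μ ^ 2) / μ ^ 2 - (rate v μ / phase v μ) ^ 2 - defect v μ = T p := by
    rw [e2, rate_div_phase hμ hH, hT]
    simp only [hp]
    field_simp
    ring
  have k1 := h1 p hmem
  have k2 := h2 p hmem
  have k3 := h3 p hmem
  rw [Real.norm_eq_abs] at k1 k2 k3
  have := le_abs_self C1
  have := le_abs_self C2
  have := le_abs_self C3
  have := abs_nonneg C1
  have := abs_nonneg C2
  have := abs_nonneg C3
  refine ⟨?_, ?_, ?_, ?_⟩
  · rw [e1, abs_mul, abs_of_pos hμ, mul_comm]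
    exact mul_le_mul_of_nonneg_right (by linarith) hμ.le
  · linarith
  · rw [e2]; linarith
  · rw [e3]; linarith

/-! ### Comparison of the waves with Bessel functions. -/

/-- Comparison of a perturbed Bessel system with the Bessel functions. -/
theorem perturbed_bessel {d K : ℝ} (hd : 0 < d) (hK : 1 ≤ K) :
    ∃ C : ℝ, 0 < C ∧ ∀ n v M : ℝ, ∀ X Y e₁ e₂ : ℝ → ℝ, 1 ≤ n → 0 < M → M ≤ 1 →
      v ^ 2 * (1 + M ^ 2) ≤ 1 - d ^ 2 →
      (∀ μ ∈ Set.Ioc 0 M, HasDerivAt X ((-(n * rate v μ * Y μ) + e₁ μ) / (1 + μ ^ 2)) μ) →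
      (∀ μ ∈ Set.Ioc 0 M, HasDerivAt Y
        ((n * rate v μ * X μ - rate v μ / phase v μ * Y μ + e₂ μ) / (1 + μ ^ 2)) μ) →
      (∀ μ ∈ Set.Ioc 0 M, |e₁ μ| ≤ K / n * |Y μ| ∧ |e₂ μ| ≤ K / n * |X μ|) →
      Tendsto X (𝓝[>] 0) (𝓝 1) → Tendsto Y (𝓝[>] 0) (𝓝 0) →
      |X M - besselJ₀ (n * phase v M)| ≤ C * (√M / (n * √n)) ∧
      |Y M - besselJ₁ (n * phase v M)| ≤ C * (√M / (n * √n)) := by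
  obtain ⟨B, hB, hJ⟩ := sqrtJ_bounded
  have hd2 : 0 < √(d / 2) := Real.sqrt_pos.2 (by positivity)
  refine ⟨Real.exp (2 * K) * (4 * K * B / √(d / 2)), by positivity, ?_⟩
  intro n v M X Y e₁ e₂ hn hM hM1 hv hX hY he hX0 hY0
  have hn0 : 0 < n := by linarith
  have hsn : 0 < √n := Real.sqrt_pos.2 hn0
  have hv' : ∀ μ ∈ Set.Ioc 0 M, v ^ 2 * (1 + μ ^ 2) ≤ 1 - d ^ 2 := fun μ hμ =>
    sq_mul_mono hv hμ.1.le hμ.2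
  have hv1 : ∀ μ ∈ Set.Ioc 0 M, v ^ 2 * (1 + μ ^ 2) < 1 := fun μ hμ => by
    nlinarith [hv' μ hμ]
  have hHpos : ∀ μ ∈ Set.Ioc 0 M, 0 < phase v μ := fun μ hμ =>
    phase_pos hμ.1 (hμ.2.trans hM1) (hv1 μ hμ)
  have hζ : ∀ μ ∈ Set.Ioc 0 M, HasDerivAt (fun μ => n * phase v μ)
      (n * (rate v μ / (1 + μ ^ 2))) μ := fun μ hμ => (hasDerivAt_phase (hv1 μ hμ)).const_mul n
  have hf : ∀ μ ∈ Set.Ioc 0 M, HasDerivAt (fun μ => X μ - besselJ₀ (n * phase v μ))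
      ((-(n * rate v μ * (Y μ - besselJ₁ (n * phase v μ))) + e₁ μ) / (1 + μ ^ 2)) μ := by
    intro μ hμ
    convert! (hX μ hμ).sub ((hasDerivAt_besselJ₀ _).comp μ (hζ μ hμ)) using 1
    field_simp
    ring
  have hg : ∀ μ ∈ Set.Ioc 0 M, HasDerivAt (fun μ => Y μ - besselJ₁ (n * phase v μ))
      ((n * rate v μ * (X μ - besselJ₀ (n * phase v μ)) -
        rate v μ / phase v μ * (Y μ - besselJ₁ (n * phase v μ)) + e₂ μ) / (1 + μ ^ 2)) μ := by
    intro μ hμ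
    have hH := hHpos μ hμ
    convert! (hY μ hμ).sub ((hasDerivAt_besselJ₁ (mul_pos hn0 hH).ne').comp μ (hζ μ hμ)) using 1
    field_simp
    ring
  have hlim : Tendsto (fun μ => n * phase v μ) (𝓝[>] 0) (𝓝 0) := by
    have h0 : v ^ 2 * (1 + (0 : ℝ) ^ 2) < 1 := by
      have := sq_mul_mono hv le_rfl hM.le
      nlinarith
    have := ((hasDerivAt_phase h0).continuousAt.tendsto.const_mul n).mono_left
      (nhdsWithin_le_nhds (s := Set.Ioi 0))
    simpa [phase_zero] using this
  have hJ0 : Tendsto (fun μ => besselJ₀ (n * phase v μ)) (𝓝[>] 0) (𝓝 1) := by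
    have := (hasDerivAt_besselJ₀ 0).continuousAt.tendsto
    rw [besselJ₀_zero] at this
    exact this.comp hlim
  have hJ1 : Tendsto (fun μ => besselJ₁ (n * phase v μ)) (𝓝[>] 0) (𝓝 0) := by
    have := (hasDerivAt_besselJ₁_integral 0).continuousAt.tendsto
    rw [besselJ₁_zero] at this
    exact this.comp hlim
  -- Since phase ≥ dμ/2, the decay z^(-1/2) becomes a forcing of size μ^(-1/2), integrable at 0.
  have hJb : ∀ μ ∈ Set.Ioc 0 M, |besselJ₀ (n * phase v μ)| ≤ B / (√n * √(d / 2)) / √μ ∧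
      |besselJ₁ (n * phase v μ)| ≤ B / (√n * √(d / 2)) / √μ := by
    intro μ hμ
    have hsμ : 0 < √μ := Real.sqrt_pos.2 hμ.1
    have h1 := (phase_bounds hd hμ.1.le (hμ.2.trans hM1) (hv' μ hμ)).1
    have h2 : √n * √(d / 2) * √μ ≤ √(n * phase v μ) := by
      rw [← Real.sqrt_mul hn0.le, ← Real.sqrt_mul (by positivity)]
      refine Real.sqrt_le_sqrt ?_
      rw [mul_assoc]
      refine mul_le_mul_of_nonneg_left ?_ hn0.le
      linarith
    have hz : 0 < n * phase v μ := mul_pos hn0 (hHpos μ hμ)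
    obtain ⟨j0, j1⟩ := hJ _ hz
    rw [sqrtJ₀, abs_mul, abs_of_nonneg (Real.sqrt_nonneg _)] at j0
    rw [sqrtJ₁, abs_mul, abs_of_nonneg (Real.sqrt_nonneg _)] at j1
    rw [div_div]
    constructor <;> rw [le_div_iff₀ (by positivity), mul_comm]
    · exact (mul_le_mul_of_nonneg_right h2 (abs_nonneg _)).trans j0
    · exact (mul_le_mul_of_nonneg_right h2 (abs_nonneg _)).trans j1
  have hE := energy_le (f := fun μ => X μ - besselJ₀ (n * phase v μ))
    (g := fun μ => Y μ - besselJ₁ (n * phase v μ)) (a := 2 * K / n)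
    (b := 2 * K / n * (B / (√n * √(d / 2)))) (M := M) (by positivity) (by positivity) hM hf hg ?_
    (by simpa using hX0.sub hJ0) (by simpa using hY0.sub hJ1)
  · have hexp : Real.exp (2 * K / n * M) ≤ Real.exp (2 * K) := by
      refine Real.exp_le_exp.2 ?_
      rw [div_mul_eq_mul_div, div_le_iff₀ hn0]
      nlinarith
    have hfin : Real.exp (2 * K / n * M) * (2 * (2 * K / n * (B / (√n * √(d / 2)))) * √M) ≤
        Real.exp (2 * K) * (4 * K * B / √(d / 2)) * (√M / (n * √n)) := by
      refine (mul_le_mul_of_nonneg_right hexp (by positivity)).trans (le_of_eq ?_)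
      field_simp
      ring
    have h3 := hE.trans hfin
    constructor
    · refine le_trans (Real.abs_le_sqrt ?_) h3
      linarith [sq_nonneg (Y M - besselJ₁ (n * phase v M))]
    · refine le_trans (Real.abs_le_sqrt ?_) h3
      linarith [sq_nonneg (X M - besselJ₀ (n * phase v M))]
  · intro μ hμ
    set f := X μ - besselJ₀ (n * phase v μ) with hf'
    set g := Y μ - besselJ₁ (n * phase v μ) with hg'
    set N := √(f ^ 2 + g ^ 2) with hN
    have hN0 : 0 ≤ N := Real.sqrt_nonneg _
    have hfN : |f| ≤ N := Real.abs_le_sqrt (by linarith [sq_nonneg g])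
    have hgN : |g| ≤ N := Real.abs_le_sqrt (by linarith [sq_nonneg f])
    obtain ⟨j0, j1⟩ := hJb μ hμ
    obtain ⟨i1, i2⟩ := he μ hμ
    set b := B / (√n * √(d / 2)) / √μ with hb
    have hXb : |X μ| ≤ N + b := by
      rw [show X μ = f + besselJ₀ (n * phase v μ) by rw [hf']; ring]
      exact (abs_add_le _ _).trans (add_le_add hfN j0)
    have hYb : |Y μ| ≤ N + b := by
      rw [show Y μ = g + besselJ₁ (n * phase v μ) by rw [hg']; ring]
      exact (abs_add_le _ _).trans (add_le_add hgN j1)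
    have hKn : 0 < K / n := by positivity
    have h1 : f * e₁ μ ≤ N * (K / n * (N + b)) := by
      refine (le_abs_self _).trans ?_
      rw [abs_mul]
      exact mul_le_mul hfN (i1.trans (mul_le_mul_of_nonneg_left hYb hKn.le)) (abs_nonneg _) hN0
    have h2 : g * e₂ μ ≤ N * (K / n * (N + b)) := by
      refine (le_abs_self _).trans ?_
      rw [abs_mul]
      exact mul_le_mul hgN (i2.trans (mul_le_mul_of_nonneg_left hXb hKn.le)) (abs_nonneg _) hN0
    -- The rotation terms with n · rate cancel in the energy. The coefficient rate/phase is
    -- unbounded at 0, but enters with a favourable sign and can be dropped.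
    have h3 : 0 ≤ rate v μ / phase v μ * g ^ 2 := by
      have := rate_pos (hv1 μ hμ)
      have := hHpos μ hμ
      positivity
    have h4 : 0 ≤ N * (2 * K / n * N + 2 * K / n * (B / (√n * √(d / 2))) / √μ) := by positivity
    calc _ = (f * e₁ μ + g * e₂ μ - rate v μ / phase v μ * g ^ 2) / (1 + μ ^ 2) := by ring
      _ ≤ N * (2 * K / n * N + 2 * K / n * (B / (√n * √(d / 2))) / √μ) / (1 + μ ^ 2) := by
        refine div_le_div_of_nonneg_right ?_ (by positivity)
        have : N * (2 * K / n * N + 2 * K / n * (B / (√n * √(d / 2))) / √μ) =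
          2 * (N * (K / n * (N + b))) := by rw [hb]; ring
        rw [this]
        linarith
      _ ≤ _ := div_le_self h4 (by nlinarith [sq_nonneg μ])

/-- `gain` is chosen so that the friction term becomes that of Bessel's equation in n · phase. The
companion of gain · F is defined so that the analogue of J₀' = -J₁ is exact; the whole defect then
sits in the analogue of J₁' = J₀ - J₁/z, divided by n · rate. -/
theorem hasDerivAt_bessel_zero {n v μ : ℝ} {F F' : ℝ → ℝ} (hn : 0 < n) (hF : SolvesWave 0 n v F F')
    (hμ : 0 < μ) (hμ1 : μ ≤ 1) (h : v ^ 2 * (1 + μ ^ 2) < 1) :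
    HasDerivAt (fun μ => gain v μ * F μ) ((-(n * rate v μ *
      (-(gain v μ * (F' μ + gainLog v μ * F μ) / (n * rate v μ)))) + 0) / (1 + μ ^ 2)) μ ∧
    HasDerivAt (fun μ => -(gain v μ * (F' μ + gainLog v μ * F μ) / (n * rate v μ)))
      ((n * rate v μ * (gain v μ * F μ) - rate v μ / phase v μ *
        (-(gain v μ * (F' μ + gainLog v μ * F μ) / (n * rate v μ))) +
        defect v μ / (n * rate v μ) * (gain v μ * F μ)) / (1 + μ ^ 2)) μ := by
  have hh := rate_pos h
  have hH := phase_pos hμ hμ1 h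
  obtain ⟨d1, d2⟩ := hF μ hμ
  have dg := hasDerivAt_gain hμ hμ1 h
  have dl := hasDerivAt_gainLog hμ hμ1 h
  have dh := hasDerivAt_rate h
  constructor
  · convert! dg.mul d1 using 1
    field_simp
    ring
  · convert! ((dg.mul (d2.add (dl.mul d1))).div (dh.const_mul n) (by positivity)).neg using 1
    simp only [Pi.mul_apply, Pi.add_apply]
    rw [defect, gainLog]
    have hr := rate_sq h
    generalize gainLogD v μ = r'
    generalize rate v μ = R at *
    generalize phase v μ = H at *
    generalize gain v μ = G
    generalize F μ = f
    generalize F' μ = f'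
    field_simp
    linear_combination (4 * G * R ^ 4 * μ ^ 2 * n ^ 2 * f * H ^ 2) * hr

/-- Here gain · F plays J₁ and the equation for J₁' is exact, so the error falls on J₀'. The
singular term (1 + μ²)/μ² is matched by (rate/phase)², the counterpart of 1/z². -/
theorem hasDerivAt_bessel_one {n v μ : ℝ} {F F' : ℝ → ℝ} (hn : 0 < n) (hF : SolvesWave 1 n v F F')
    (hμ : 0 < μ) (hμ1 : μ ≤ 1) (h : v ^ 2 * (1 + μ ^ 2) < 1) :
    HasDerivAt (fun μ => gain v μ * (F' μ + gainLog v μ * F μ) / (n * rate v μ) +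
        gain v μ * F μ / (n * phase v μ))
      ((-(n * rate v μ * (gain v μ * F μ)) + ((1 + μ ^ 2) / μ ^ 2 - (rate v μ / phase v μ) ^ 2 -
        defect v μ) / (n * rate v μ) * (gain v μ * F μ)) / (1 + μ ^ 2)) μ ∧
    HasDerivAt (fun μ => gain v μ * F μ)
      ((n * rate v μ * (gain v μ * (F' μ + gainLog v μ * F μ) / (n * rate v μ) +
        gain v μ * F μ / (n * phase v μ)) - rate v μ / phase v μ * (gain v μ * F μ) + 0) /
        (1 + μ ^ 2)) μ := by
  have hh := rate_pos h
  have hH := phase_pos hμ hμ1 h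
  obtain ⟨d1, d2⟩ := hF μ hμ
  have dg := hasDerivAt_gain hμ hμ1 h
  have dl := hasDerivAt_gainLog hμ hμ1 h
  have dh := hasDerivAt_rate h
  have dH := hasDerivAt_phase h
  constructor
  · convert! ((dg.mul (d2.add (dl.mul d1))).div (dh.const_mul n) (by positivity)).add
      ((dg.mul d1).div (dH.const_mul n) (by positivity)) using 1
    simp only [Pi.mul_apply, Pi.add_apply]
    rw [defect, gainLog]
    have hr := rate_sq h
    generalize gainLogD v μ = r'
    generalize rate v μ = R at *
    generalize phase v μ = H at *
    generalize gain v μ = G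
    generalize F μ = f
    generalize F' μ = f'
    field_simp
    linear_combination (-4 * G * R ^ 4 * μ ^ 2 * n ^ 2 * f * H ^ 2) * hr
  · convert! dg.mul d1 using 1
    field_simp
    ring

theorem tendsto_gain {v M d : ℝ} (hd : 0 < d) (hM : 0 < M) (h : v ^ 2 * (1 + M ^ 2) ≤ 1 - d ^ 2) :
    Tendsto (rate v) (𝓝[>] 0) (𝓝 (rate v 0)) ∧ 0 < rate v 0 ∧
    Tendsto (fun μ => μ / phase v μ) (𝓝[>] 0) (𝓝 (rate v 0)⁻¹) ∧
    Tendsto (gain v) (𝓝[>] 0) (𝓝 1) ∧ Tendsto (gainLog v) (𝓝[>] 0) (𝓝 0) := by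
  have h0 : v ^ 2 * (1 + (0 : ℝ) ^ 2) < 1 := by
    have := sq_mul_mono h le_rfl hM.le
    nlinarith
  have hr := (hasDerivAt_rate h0).continuousAt.tendsto.mono_left
    (nhdsWithin_le_nhds (s := Set.Ioi 0))
  have hr0 := rate_pos h0
  have hp : Tendsto (fun μ => μ / phase v μ) (𝓝[>] 0) (𝓝 (rate v 0)⁻¹) := by
    have h1 := (hasDerivAt_iff_tendsto_slope.1 (hasDerivAt_phase h0)).mono_left
      (nhdsWithin_mono 0 fun x (hx : 0 < x) => hx.ne')
    rw [zero_pow two_ne_zero, add_zero, div_one] at h1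
    refine (h1.inv₀ hr0.ne').congr fun μ => ?_
    rw [slope_def_field, phase_zero, sub_zero, sub_zero, inv_div]
  refine ⟨hr, hr0, hp, ?_, ?_⟩
  · have h1 := (hr.mul hp).sqrt
    rw [mul_inv_cancel₀ hr0.ne', Real.sqrt_one] at h1
    refine h1.congr fun μ => ?_
    rw [gain]
    congr 1
    ring
  · obtain ⟨K, -, hK⟩ := gain_estimates hd
    have hlim : Tendsto (fun μ : ℝ => K * μ) (𝓝[>] 0) (𝓝 0) := by
      have : ContinuousAt (fun μ : ℝ => K * μ) 0 := by fun_prop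
      simpa using this.tendsto.mono_left (nhdsWithin_le_nhds (s := Set.Ioi 0))
    refine squeeze_zero_norm' ?_ hlim
    filter_upwards [Ioc_mem_nhdsGT (lt_min hM one_pos)] with s hs
    exact (hK v s hs.1 (hs.2.trans (min_le_right _ _))
      (sq_mul_mono h hs.1.le (hs.2.trans (min_le_left _ _)))).1

theorem solvesWave_bessel {d : ℝ} (hd : 0 < d) (hd1 : d ≤ 1) :
    ∃ C : ℝ, 0 < C ∧ ∀ n v M : ℝ, ∀ F F' : ℝ → ℝ, 1 ≤ n → 0 < M → M ≤ 1 →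
      v ^ 2 * (1 + M ^ 2) ≤ 1 - d ^ 2 →
      (SolvesWave 0 n v F F' → Tendsto F (𝓝[>] 0) (𝓝 1) → Tendsto F' (𝓝[>] 0) (𝓝 0) →
        |gain v M * F M - besselJ₀ (n * phase v M)| ≤ C * (√M / (n * √n))) ∧
      (SolvesWave 1 n v F F' → Tendsto (fun μ => F μ / μ) (𝓝[>] 0) (𝓝 (n * rate v 0 / 2)) →
        Tendsto F' (𝓝[>] 0) (𝓝 (n * rate v 0 / 2)) →
        |gain v M * F M - besselJ₁ (n * phase v M)| ≤ C * (√M / (n * √n))) := by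
  obtain ⟨K, hK1, hK⟩ := gain_estimates hd
  -- The defect is divided by n · rate ≥ n · d, whence K / d.
  obtain ⟨C, hC, hbes⟩ := perturbed_bessel (K := K / d) hd (by rw [le_div_iff₀ hd]; linarith)
  refine ⟨C, hC, fun n v M F F' hn hM hM1 hv => ?_⟩
  have hn0 : 0 < n := by linarith
  have hv' : ∀ μ ∈ Set.Ioc 0 M, v ^ 2 * (1 + μ ^ 2) ≤ 1 - d ^ 2 := fun μ hμ =>
    sq_mul_mono hv hμ.1.le hμ.2
  have hv1 : ∀ μ ∈ Set.Ioc 0 M, v ^ 2 * (1 + μ ^ 2) < 1 := fun μ hμ => by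
    nlinarith [hv' μ hμ]
  obtain ⟨t1, t2, t3, t4, t5⟩ := tendsto_gain hd hM hv
  have hbound : ∀ μ ∈ Set.Ioc 0 M, ∀ a x : ℝ, |a| ≤ K →
      |a / (n * rate v μ) * x| ≤ K / d / n * |x| := by
    intro μ hμ a x ha
    have hr := le_rate (hv' μ hμ)
    have hr0 := rate_pos (hv1 μ hμ)
    rw [abs_mul, abs_div, abs_of_pos (mul_pos hn0 hr0), div_div]
    refine mul_le_mul_of_nonneg_right ?_ (abs_nonneg x)
    rw [mul_comm n]
    exact div_le_div₀ (by linarith) ha (by positivity) (mul_le_mul_of_nonneg_right hr hn0.le)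
  constructor
  · intro hF hF0 hF'0
    refine (hbes n v M _ _ (fun _ => 0) _ hn hM hM1 hv
      (fun μ hμ => (hasDerivAt_bessel_zero hn0 hF hμ.1 (hμ.2.trans hM1) (hv1 μ hμ)).1)
      (fun μ hμ => (hasDerivAt_bessel_zero hn0 hF hμ.1 (hμ.2.trans hM1) (hv1 μ hμ)).2)
      (fun μ hμ => ⟨?_, ?_⟩) (by simpa using t4.mul hF0) ?_).1
    · rw [abs_zero]; positivity
    · exact hbound μ hμ _ _ (hK v μ hμ.1 (hμ.2.trans hM1) (hv' μ hμ)).2.2.1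
    · have := ((t4.mul (hF'0.add (t5.mul hF0))).div (t1.const_mul n) (by positivity)).neg
      simpa using this
  · intro hF hF0 hF'0
    have hid : Tendsto (fun μ : ℝ => μ) (𝓝[>] 0) (𝓝 0) :=
      tendsto_id.mono_left nhdsWithin_le_nhds
    have hF00 : Tendsto F (𝓝[>] 0) (𝓝 0) := by
      have h1 := hF0.mul hid
      rw [mul_zero] at h1
      refine h1.congr' ?_
      filter_upwards [self_mem_nhdsWithin] with μ hμ
      exact div_mul_cancel₀ _ (ne_of_gt hμ)
    refine (hbes n v M _ _ _ (fun _ => 0) hn hM hM1 hv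
      (fun μ hμ => (hasDerivAt_bessel_one hn0 hF hμ.1 (hμ.2.trans hM1) (hv1 μ hμ)).1)
      (fun μ hμ => (hasDerivAt_bessel_one hn0 hF hμ.1 (hμ.2.trans hM1) (hv1 μ hμ)).2)
      (fun μ hμ => ⟨?_, ?_⟩) ?_ (by simpa using t4.mul hF00)).2
    · exact hbound μ hμ _ _ (hK v μ hμ.1 (hμ.2.trans hM1) (hv' μ hμ)).2.2.2
    · rw [abs_zero]; positivity
    · have h1 := (t4.mul (hF'0.add (t5.mul hF00))).div (t1.const_mul n) (by positivity)
      have h2 := ((t4.mul hF0).mul t3).div_const n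
      have h3 := h1.add h2
      -- Derivative and quotient each contribute 1/2, adding up to J₀(0) = 1.
      have e : 1 * (n * rate v 0 / 2 + 0 * 0) / (n * rate v 0) +
          1 * (n * rate v 0 / 2) * (rate v 0)⁻¹ / n = 1 := by
        field_simp
        ring
      rw [e] at h3
      refine h3.congr' ?_
      filter_upwards [self_mem_nhdsWithin] with μ hμ
      have : μ ≠ 0 := ne_of_gt hμ
      congr 1
      field_simp

/-! ### Bessel asymptotics recovered from the explicit lattice values. -/

/-- The wave with velocity `0` at `μ = 1` determines the asymptotics of `√z J₀(z)`. -/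
theorem abs_wave_sub_sqrtJ₀_le : ∃ C : ℝ, ∀ N : ℕ,
    |√(2 * N + 1) * wave 0 N N 1 - sqrtJ₀ ((2 * N + 1) * Real.pi / 4)| ≤ C / (2 * N + 1) := by
  -- At velocity 0 the rate is identically 1, so d = 1 is admissible up to μ = 1, where the phase is
  -- π/4.
  obtain ⟨C, hC, h⟩ := solvesWave_bessel one_pos le_rfl
  refine ⟨C, fun N => ?_⟩
  have hw := solvesWave_zero N N
  rw [sub_self, zero_div] at hw
  have t0 := tendsto_wave 0 N N
  rw [Nat.choose_zero_right, Nat.cast_one] at t0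
  have hn : (1 : ℝ) ≤ 2 * N + 1 := by linarith [Nat.cast_nonneg (α := ℝ) N]
  rw [show (N : ℝ) + N + 1 = 2 * N + 1 by ring] at hw
  have h1 := (h _ 0 1 _ _ hn one_pos le_rfl (by norm_num)).1 hw t0 (tendsto_waveD 0 N N)
  have hp : phase 0 1 = Real.pi / 4 := by
    have : (1 : ℝ) / √((1 + 1 ^ 2) * (1 - 0 ^ 2)) = √2 / 2 := by
      norm_num
      rw [inv_eq_one_div, div_eq_div_iff (by positivity) (by positivity)]
      norm_num
    rw [phase, this, ← Real.sin_pi_div_four, Real.arcsin_sin] <;> [simp; skip; skip] <;>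
      linarith [Real.pi_pos]
  have hr : rate 0 1 = 1 := by simp [rate]
  set n : ℝ := 2 * N + 1 with hn'
  have hn0 : 0 < n := by linarith
  have hsn : √n * √n = n := Real.mul_self_sqrt hn0.le
  have hsn0 : 0 < √n := Real.sqrt_pos.2 hn0
  have hs : √(n * Real.pi / 4) = √n * (√Real.pi / 2) := by
    rw [mul_div_assoc, Real.sqrt_mul hn0.le, Real.sqrt_div Real.pi_pos.le,
      show (4 : ℝ) = 2 ^ 2 by norm_num, Real.sqrt_sq two_pos.le]
  have hg : gain 0 1 * (√Real.pi / 2) = 1 := by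
    rw [gain, hp, hr, one_mul, one_div_div, Real.sqrt_div (by norm_num),
      show (4 : ℝ) = 2 ^ 2 by norm_num, Real.sqrt_sq two_pos.le]
    have := Real.sqrt_pos.2 Real.pi_pos
    field_simp
  rw [hp, Real.sqrt_one, ← mul_div_assoc] at h1
  have e : √n * wave 0 N N 1 - sqrtJ₀ (n * Real.pi / 4) = (√n * (√Real.pi / 2)) *
      (gain 0 1 * wave 0 N N 1 - besselJ₀ (n * Real.pi / 4)) := by
    rw [sqrtJ₀, hs]
    linear_combination (-√n * wave 0 N N 1) * hg
  have hpi : √Real.pi / 2 ≤ 1 := by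
    rw [div_le_one two_pos, Real.sqrt_le_left two_pos.le]
    linarith [Real.pi_lt_four]
  rw [e, abs_mul, abs_of_pos (by positivity)]
  calc _ ≤ (√n * 1) * (C * (1 / (n * √n))) := by gcongr
    _ = _ := by field_simp

/-- With N = 2M and N = 2M + 1 the comparison points (2N + 1)π/4 are exactly the two sequences that
fix the amplitudes. -/
theorem sqrtJ_asymptotics :
    ∃ B : ℝ, 1 ≤ B ∧ ∀ z, 0 < z →
      |sqrtJ₀ z - √(2 / Real.pi) * Real.sin (z + Real.pi / 4)| ≤ B / z ∧
      |sqrtJ₁ z + √(2 / Real.pi) * Real.cos (z + Real.pi / 4)| ≤ B / z := by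
  obtain ⟨C, hC⟩ := abs_wave_sub_sqrtJ₀_le
  have key : ∀ (f g : ℕ → ℝ) (c L : ℝ), Tendsto f atTop (𝓝 L) →
      (∀ M : ℕ, |f M - g M| ≤ C / (4 * M + c)) → Tendsto g atTop (𝓝 L) := by
    intro f g c L hf hfg
    have h0 : Tendsto (fun M : ℕ => C / (4 * (M : ℝ) + c)) atTop (𝓝 0) :=
      tendsto_const_nhds.div_atTop (tendsto_atTop_add_const_right _ _
        (tendsto_natCast_atTop_atTop.const_mul_atTop (by norm_num)))
    have h1 : Tendsto (fun M => f M - g M) atTop (𝓝 0) := squeeze_zero_norm hfg h0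
    simpa using hf.sub h1
  have hpow : ∀ (M : ℕ) (x y : ℝ), |(-1) ^ M * x - (-1) ^ M * y| = |x - y| := fun M x y => by
    rw [← mul_sub, abs_mul, abs_pow, abs_neg, abs_one, one_pow, one_mul]
  refine sqrtJ_asymp (key _ _ 1 _ tendsto_wave_even fun M => ?_)
    (key (fun _ => 0) _ 3 _ tendsto_const_nhds fun M => ?_)
  · have := hC (2 * M)
    rw [mul_left_comm, hpow]
    rwa [show 2 * ((2 * M : ℕ) : ℝ) + 1 = 4 * M + 1 by push_cast; ring] at this
  · have := hC (2 * M + 1)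
    rw [wave_odd, mul_zero] at this
    rw [← mul_zero ((-1 : ℝ) ^ M), hpow]
    rwa [show 2 * ((2 * M + 1 : ℕ) : ℝ) + 1 = 4 * M + 3 by push_cast; ring] at this

/-! ### Trigonometric asymptotics of the waves. -/

/-- From the comparison with a Bessel function to trigonometric asymptotics. -/
theorem abs_sub_amplitude_le {d B C n v μ f J s : ℝ} (hd : 0 < d) (hd1 : d ≤ 1) (hB : 0 ≤ B)
    (hC : 0 ≤ C) (hn : 1 ≤ n) (hμ : 0 < μ) (hμ1 : μ ≤ 1) (hv : v ^ 2 * (1 + μ ^ 2) ≤ 1 - d ^ 2)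
    (hf : |gain v μ * f - J| ≤ C * (√μ / (n * √n)))
    (hJ : |√(n * phase v μ) * J - s| ≤ B / (n * phase v μ)) :
    |μ * f - √μ / √(n * rate v μ) * s| ≤ (C + 4 * B / d ^ 2) / d * (1 / (√μ * (n * √n))) := by
  have hv1 : v ^ 2 * (1 + μ ^ 2) < 1 := by nlinarith
  have hh := rate_pos hv1
  have hdh := le_rate hv
  have hH := phase_pos hμ hμ1 hv1
  obtain ⟨b1, b2, -⟩ := phase_bounds hd hμ.le hμ1 hv
  have hn0 : 0 < n := by linarith
  have hz : 0 < n * phase v μ := mul_pos hn0 hH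
  have hq : 0 < μ * rate v μ / phase v μ := by positivity
  have hg : 0 < gain v μ := Real.sqrt_pos.2 hq
  have hdg : d ≤ gain v μ := by
    refine Real.le_sqrt_of_sq_le ?_
    rw [le_div_iff₀ hH]
    have : d ^ 2 ≤ rate v μ := by nlinarith
    calc d ^ 2 * phase v μ ≤ rate v μ * μ := by gcongr
      _ = _ := mul_comm _ _
  have hsz : 0 < √(n * phase v μ) := Real.sqrt_pos.2 hz
  have hsμ : 0 < √μ := Real.sqrt_pos.2 hμ
  have hsn : 0 < √n := Real.sqrt_pos.2 hn0
  have hsnh : 0 < √(n * rate v μ) := Real.sqrt_pos.2 (mul_pos hn0 hh)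
  -- The phase cancels between the gain and the Bessel normalization √z, leaving only the rate in
  -- the amplitude.
  have hmain : √μ / √(n * rate v μ) = μ / gain v μ / √(n * phase v μ) := by
    rw [div_div, gain, ← Real.sqrt_mul hq.le,
      show μ * rate v μ / phase v μ * (n * phase v μ) = μ * (n * rate v μ) by field_simp,
      Real.sqrt_mul hμ.le, div_eq_div_iff (by positivity) (by positivity)]
    linear_combination √(n * rate v μ) * Real.mul_self_sqrt hμ.le
  have hsplit : μ * f - √μ / √(n * rate v μ) * s = μ / gain v μ * ((gain v μ * f - J) +
      (√(n * phase v μ) * J - s) / √(n * phase v μ)) := by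
    rw [hmain]
    field_simp
    ring
  have hzlow : (d / 2) ^ 2 * (n * μ * (√n * √μ)) ≤ n * phase v μ * √(n * phase v μ) := by
    have h1 : d / 2 * (n * μ) ≤ n * phase v μ := by nlinarith
    have h2 : d / 2 * (√n * √μ) ≤ √(n * phase v μ) := by
      refine Real.le_sqrt_of_sq_le (le_trans ?_ h1)
      rw [mul_pow, mul_pow, Real.sq_sqrt hn0.le, Real.sq_sqrt hμ.le]
      refine mul_le_mul_of_nonneg_right ?_ (by positivity)
      nlinarith
    calc _ = d / 2 * (n * μ) * (d / 2 * (√n * √μ)) := by ring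
      _ ≤ _ := mul_le_mul h1 h2 (by positivity) hz.le
  have hJ' : |(√(n * phase v μ) * J - s) / √(n * phase v μ)| ≤
      B * (4 / d ^ 2) / (n * μ * (√n * √μ)) := by
    rw [abs_div, abs_of_pos hsz, div_le_iff₀ hsz]
    refine hJ.trans ?_
    rw [div_mul_eq_mul_div, div_le_div_iff₀ hz (by positivity)]
    calc B * (n * μ * (√n * √μ)) = B * (4 / d ^ 2) * ((d / 2) ^ 2 * (n * μ * (√n * √μ))) := by
          field_simp
          norm_num
      _ ≤ B * (4 / d ^ 2) * (n * phase v μ * √(n * phase v μ)) := by gcongr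
      _ = _ := by ring
  -- The comparison error carries μ√μ and the Bessel error 1/√μ; as μ ≤ 1 the latter absorbs the
  -- former.
  have hμμ : μ * √μ ≤ 1 / √μ := by
    rw [le_div_iff₀ hsμ, mul_assoc, Real.mul_self_sqrt hμ.le]
    nlinarith
  rw [hsplit, abs_mul, abs_of_pos (div_pos hμ hg)]
  calc _ ≤ μ / d * (C * (√μ / (n * √n)) + B * (4 / d ^ 2) / (n * μ * (√n * √μ))) := by
        refine mul_le_mul ?_ ((abs_add_le _ _).trans (add_le_add hf hJ')) (abs_nonneg _)
          (by positivity)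
        exact div_le_div_of_nonneg_left hμ.le hd hdg
    _ = C / d * (μ * √μ) * (1 / (n * √n)) + B * (4 / d ^ 2) / d * (1 / √μ) * (1 / (n * √n)) := by
        field_simp
    _ ≤ C / d * (1 / √μ) * (1 / (n * √n)) + B * (4 / d ^ 2) / d * (1 / √μ) * (1 / (n * √n)) := by
        gcongr
    _ = _ := by
        field_simp

theorem wave_asymptotics {d : ℝ} (hd : 0 < d) (hd1 : d ≤ 1) :
    ∃ K : ℝ, 0 < K ∧ ∀ (A B : ℕ) (n v μ : ℝ), n = A + B + 1 → 0 < μ → μ ≤ 1 →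
      v ^ 2 * (1 + μ ^ 2) ≤ 1 - d ^ 2 →
      (v * n = A - B → |μ * wave 0 A B μ - √μ / √(n * rate v μ) *
        (√(2 / Real.pi) * Real.sin (n * phase v μ + Real.pi / 4))| ≤ K * (1 / (√μ * (n * √n)))) ∧
      (v * n = A - B - 1 → |-μ ^ 2 * wave 1 A B μ - √((1 + v) / (1 - v)) *
        (√μ / √(n * rate v μ) * (√(2 / Real.pi) * Real.cos (n * phase v μ + Real.pi / 4)))| ≤
          K * (1 / (√μ * (n * √n)))) := by
  obtain ⟨C, hC, hw⟩ := solvesWave_bessel hd hd1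
  obtain ⟨B₀, hB₀, hJ⟩ := sqrtJ_asymptotics
  set K₀ := (C + 4 * B₀ / d ^ 2) / d with hK₀
  have hK₀pos : 0 < K₀ := by positivity
  -- The term 2/d bounds the extra factor √((1 + v)/(1 - v)) of the second component.
  refine ⟨(1 + 2 / d) * K₀, by positivity, fun A B n v μ hn hμ hμ1 hv => ?_⟩
  have hn1 : 1 ≤ n := by rw [hn]; linarith [Nat.cast_nonneg (α := ℝ) A, Nat.cast_nonneg (α := ℝ) B]
  have hn0 : 0 < n := by linarith
  have hv1 : v ^ 2 * (1 + μ ^ 2) < 1 := by nlinarith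
  have hz : 0 < n * phase v μ := mul_pos hn0 (phase_pos hμ hμ1 hv1)
  obtain ⟨j0, j1⟩ := hJ _ hz
  have hsμ : 0 < √μ := Real.sqrt_pos.2 hμ
  have hsn : 0 < √n := Real.sqrt_pos.2 hn0
  have he : 0 ≤ 1 / (√μ * (n * √n)) := by positivity
  have hd2 : 0 < 2 / d := by positivity
  constructor
  · intro hvn
    have hs := solvesWave_zero A B
    rw [← hn, ← eq_div_of_mul_eq hn0.ne' hvn] at hs
    have t0 := tendsto_wave 0 A B
    rw [Nat.choose_zero_right, Nat.cast_one] at t0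
    have h1 := (hw n v μ _ _ hn1 hμ hμ1 hv).1 hs t0 (tendsto_waveD 0 A B)
    refine (abs_sub_amplitude_le hd hd1 (by linarith) hC.le hn1 hμ hμ1 hv h1 j0).trans ?_
    refine mul_le_mul_of_nonneg_right ?_ he
    rw [← hK₀]
    nlinarith
  · intro hvn
    have hvd : v ^ 2 ≤ 1 - d ^ 2 := by nlinarith [sq_nonneg (v * μ)]
    obtain ⟨hvl, hvr⟩ : -1 < v ∧ v < 1 := by
      rw [← abs_lt, ← sq_lt_one_iff_abs_lt_one]
      nlinarith
    have hvl' : 0 < 1 + v := by linarith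
    have hvr' : 0 < 1 - v := by linarith
    have hA : (1 + v) * n = 2 * A := by linear_combination hvn + hn
    have hB : (1 - v) * n = 2 * (B + 1) := by linear_combination hn - hvn
    have hA0 : (0 : ℝ) < A := by nlinarith
    -- This c gives c · μ · `wave 1` the slope n · rate(0)/2 that matches J₁(z) ~ z/2; its inverse e
    -- becomes √((t + x)/(t - x)).
    set c := √((1 - v) / (1 + v)) with hc
    set e := √((1 + v) / (1 - v)) with he'
    have hc0 : 0 < c := Real.sqrt_pos.2 (by positivity)
    have hce : e * c = 1 := by
      rw [he', hc, ← Real.sqrt_mul (by positivity), show (1 + v) / (1 - v) * ((1 - v) / (1 + v)) = 1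
        by field_simp, Real.sqrt_one]
    have hs := solvesWave_one A B c
    rw [← hn, ← eq_div_of_mul_eq hn0.ne' hvn] at hs
    have t0 := tendsto_wave 1 A B
    have t1 := tendsto_waveD 1 A B
    rw [Nat.choose_one_right] at t0
    have hr0 : n * rate v 0 / 2 = c * A := by
      have h1 : rate v 0 = c * (1 + v) := by
        rw [rate, hc, Real.sqrt_eq_iff_mul_self_eq_of_pos (by positivity)]
        have := Real.mul_self_sqrt (by positivity : 0 ≤ (1 - v) / (1 + v))
        calc _ = √((1 - v) / (1 + v)) * √((1 - v) / (1 + v)) * (1 + v) ^ 2 := by ring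
          _ = _ := by
            rw [this]
            field_simp
            ring
      rw [h1]
      linear_combination c / 2 * hA
    have hid : Tendsto (fun μ : ℝ => μ) (𝓝[>] 0) (𝓝 0) :=
      tendsto_id.mono_left nhdsWithin_le_nhds
    have h1 := (hw n v μ _ _ hn1 hμ hμ1 hv).2 hs (by
        rw [hr0]
        refine (t0.const_mul c).congr' ?_
        filter_upwards [self_mem_nhdsWithin] with s hs
        have : s ≠ 0 := ne_of_gt hs
        field_simp) (by
        rw [hr0]
        have := ((((hid.pow 2).const_add 1).mul t0).add (hid.mul t1)).const_mul c
        simpa using this)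
    have j2 : |√(n * phase v μ) * besselJ₁ (n * phase v μ) -
        -(√(2 / Real.pi) * Real.cos (n * phase v μ + Real.pi / 4))| ≤ B₀ / (n * phase v μ) := by
      rw [sub_neg_eq_add]
      exact j1
    have h2 := abs_sub_amplitude_le hd hd1 (by linarith) hC.le hn1 hμ hμ1 hv h1 j2
    have he2 : e ≤ 2 / d := by
      rw [he', Real.sqrt_le_left (by positivity), div_pow, div_le_div_iff₀ hvr' (by positivity)]
      have : d ^ 2 ≤ 2 * (1 - v) := by nlinarith
      nlinarith
    have he0 : 0 ≤ e := Real.sqrt_nonneg _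
    have e1 : -μ ^ 2 * wave 1 A B μ - e * (√μ / √(n * rate v μ) *
        (√(2 / Real.pi) * Real.cos (n * phase v μ + Real.pi / 4))) =
        -e * (μ * (c * (μ * wave 1 A B μ)) - √μ / √(n * rate v μ) *
        -(√(2 / Real.pi) * Real.cos (n * phase v μ + Real.pi / 4))) := by
      linear_combination (μ ^ 2 * wave 1 A B μ) * hce
    rw [e1, abs_mul, abs_neg, abs_of_nonneg he0, mul_assoc]
    calc _ ≤ 2 / d * (K₀ * (1 / (√μ * (n * √n)))) := by gcongr
      _ ≤ _ := mul_le_mul_of_nonneg_right (by linarith) (by positivity)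

/-! ### Translation into x, t, m, ε and conclusion. -/

theorem theta_eq {m ε n v : ℝ} (hε : 0 < ε) (hn : 0 < n) :
    theta (v * n * ε) (n * ε) m ε = n * phase v (m * ε) + Real.pi / 4 := by
  have h1 : (n * ε) ^ 2 - (v * n * ε) ^ 2 = (n * ε) ^ 2 * (1 - v ^ 2) := by ring
  have h2 : (1 + m ^ 2 * ε ^ 2) * ((n * ε) ^ 2 - (v * n * ε) ^ 2) =
      (n * ε) ^ 2 * ((1 + (m * ε) ^ 2) * (1 - v ^ 2)) := by ring
  have hnε : 0 < n * ε := by positivity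
  rw [theta, phase, h2, h1, Real.sqrt_mul (sq_nonneg (n * ε)), Real.sqrt_mul (sq_nonneg (n * ε)),
    Real.sqrt_sq hnε.le, mul_div_cancel_right₀ _ hε.ne', mul_div_cancel_right₀ _ hε.ne',
    show m * ε * (n * ε) = (n * ε) * (m * ε) by ring,
    show m * ε * (v * n * ε) = (n * ε) * (v * (m * ε)) by ring,
    mul_div_mul_left _ _ hnε.ne', mul_div_mul_left _ _ hnε.ne']
  ring

theorem amplitude_eq {m ε n v : ℝ} (hm : 0 < m) (hε : 0 < ε) (hn : 0 < n)
    (hv : v ^ 2 * (1 + (m * ε) ^ 2) < 1) :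
    ε * √(2 * m / Real.pi) *
      ((n * ε) ^ 2 - (1 + m ^ 2 * ε ^ 2) * (v * n * ε) ^ 2) ^ (-(1 / 4) : ℝ) =
    √(m * ε) / √(n * rate v (m * ε)) * √(2 / Real.pi) := by
  have hr := rate_pos hv
  have h1 : (n * ε) ^ 2 - (1 + m ^ 2 * ε ^ 2) * (v * n * ε) ^ 2 =
      (ε * (n * rate v (m * ε))) ^ 2 := by
    linear_combination (-(ε * n) ^ 2) * rate_sq hv
  have hp : 0 < n * rate v (m * ε) := by positivity
  rw [h1, ← Real.rpow_natCast, ← Real.rpow_mul (by positivity),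
    show ((2 : ℕ) : ℝ) * (-(1 / 4)) = -(1 / 2) by norm_num, Real.rpow_neg (by positivity),
    ← Real.sqrt_eq_rpow, Real.sqrt_mul hε.le, show 2 * m / Real.pi = m * (2 / Real.pi) by ring,
    Real.sqrt_mul hm.le, Real.sqrt_mul hm.le]
  have h2 := Real.mul_self_sqrt hε.le
  have h3 := Real.sqrt_pos.2 hε
  have h4 := Real.sqrt_pos.2 hp
  generalize √(n * rate v (m * ε)) = S at *
  field_simp
  linear_combination (-1 : ℝ) * h2

theorem error_eq {m ε n : ℝ} (hm : 0 < m) (hε : 0 < ε) (hn : 0 < n) :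
    ε / (m ^ (1 / 2 : ℝ) * (n * ε) ^ (3 / 2 : ℝ)) = 1 / (√(m * ε) * (n * √n)) := by
  have h0 : 0 < n * ε := by positivity
  rw [show (3 / 2 : ℝ) = 1 + 1 / 2 by norm_num, Real.rpow_add h0, Real.rpow_one,
    ← Real.sqrt_eq_rpow, ← Real.sqrt_eq_rpow, Real.sqrt_mul hm.le, Real.sqrt_mul hn.le]
  have h1 := Real.sqrt_pos.2 hε
  have h2 := Real.sqrt_pos.2 hm
  have h3 := Real.sqrt_pos.2 hn
  field_simp

end FeynmanCheckers

theorem mainTheorem1 :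
    ∀ δ : ℝ, 0 < δ → ∃ C : ℝ, 0 < C ∧ ∃ K : ℝ, 0 < K ∧
      ∀ m ε : ℝ, 0 < m → 0 < ε → ∀ x t : ℝ, (x, t) ∈ FeynmanCheckers.lattice ε →
        |x| / t < 1 / √(1 + m ^ 2 * ε ^ 2) - δ → ε ≤ 1 / m → C / m < t →
        ((∃ k : ℤ, Odd k ∧ (x + t) / ε = k) →
          |FeynmanCheckers.a₁ x (t + ε) m ε -
            ε * √(2 * m / Real.pi)
              * (t ^ 2 - (1 + m ^ 2 * ε ^ 2) * x ^ 2) ^ (-(1 / 4) : ℝ)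
              * Real.sin (FeynmanCheckers.theta x t m ε)|
            ≤ K * (ε / (m ^ (1 / 2 : ℝ) * t ^ (3 / 2 : ℝ)))) ∧
        ((∃ k : ℤ, Even k ∧ (x + t) / ε = k) →
          |FeynmanCheckers.a₂ (x + ε) (t + ε) m ε -
            ε * √(2 * m / Real.pi)
              * (t ^ 2 - (1 + m ^ 2 * ε ^ 2) * x ^ 2) ^ (-(1 / 4) : ℝ)
              * √((t + x) / (t - x)) * Real.cos (FeynmanCheckers.theta x t m ε)|
            ≤ K * (ε / (m ^ (1 / 2 : ℝ) * t ^ (3 / 2 : ℝ)))) := by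
  intro δ hδ
  -- K is chosen before the point (x, t), so d ≤ 1 has to be forced by the minimum; once a point is
  -- given, δ ≤ 1 follows.
  obtain ⟨K, hK, h⟩ := FeynmanCheckers.wave_asymptotics (d := min δ 1) (lt_min hδ one_pos)
    (min_le_right _ _)
  -- The estimate is uniform in n ≥ 1, so the threshold only has to guarantee t > 0 and any positive
  -- constant serves.
  refine ⟨1, one_pos, K, hK, ?_⟩
  rintro m ε hm hε x t ⟨i, j, hij⟩ hxt hεm ht
  obtain ⟨rfl, rfl⟩ := Prod.mk.inj hij
  have ht0 : 0 < (j : ℝ) * ε := lt_trans (by positivity) ht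
  have hj : (0 : ℝ) < j := pos_of_mul_pos_left ht0 hε.le
  set μ := m * ε with hμ
  have hμ0 : 0 < μ := by positivity
  have hμ1 : μ ≤ 1 := by
    rw [le_div_iff₀ hm] at hεm
    linarith
  set v : ℝ := i / j with hv
  have hvj : v * j = i := div_mul_cancel₀ _ hj.ne'
  have hx : (i : ℝ) * ε = v * j * ε := by rw [hvj]
  have habs : |(i : ℝ) * ε| / (j * ε) = |v| := by
    rw [hv, abs_mul, abs_of_pos hε, abs_div, abs_of_pos hj, mul_div_mul_right _ _ hε.ne']
  rw [habs, ← mul_pow] at hxt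
  have hvd : v ^ 2 * (1 + μ ^ 2) ≤ 1 - (min δ 1) ^ 2 := by
    have hp : 0 < 1 + μ ^ 2 := by positivity
    have hs1 : 1 ≤ √(1 + μ ^ 2) := Real.one_le_sqrt.2 (by nlinarith)
    have hs2 := Real.sq_sqrt hp.le
    have h1 : (|v| + δ) * √(1 + μ ^ 2) < 1 := by
      rw [← lt_div_iff₀ (by linarith)]
      linarith
    have hv0 := abs_nonneg v
    have hδ1 : δ ≤ 1 := by nlinarith
    -- Squaring gives (1 - δ)² ≤ 1 - δ², as δ ≤ 1.
    have h2 : |v| * √(1 + μ ^ 2) ≤ 1 - δ := by nlinarith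
    rw [min_eq_left hδ1, ← sq_abs v, ← hs2, ← mul_pow]
    have h3 : 0 ≤ |v| * √(1 + μ ^ 2) := by positivity
    nlinarith
  have hv1 : v ^ 2 * (1 + μ ^ 2) < 1 := by
    have : 0 < min δ 1 := lt_min hδ one_pos
    nlinarith
  obtain ⟨hvl, hvr⟩ : -1 < v ∧ v < 1 := by
    rw [← abs_lt, ← sq_lt_one_iff_abs_lt_one]
    nlinarith [sq_nonneg (v * μ)]
  have hij1 : -j < i := by
    have : -(j : ℝ) < i := by rw [← hvj]; nlinarith
    exact_mod_cast this
  have hij2 : i < j := by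
    have : (i : ℝ) < j := by rw [← hvj]; nlinarith
    exact_mod_cast this
  have hsum : ((i : ℝ) * ε + j * ε) / ε = ((i + j : ℤ) : ℝ) := by
    push_cast
    field_simp
  rw [hsum, FeynmanCheckers.error_eq hm hε hj]
  constructor
  · rintro ⟨k, hk, hk'⟩
    obtain ⟨l, hl⟩ : Odd (i + j) := by rwa [Int.cast_injective hk']
    -- A and B + 1 count the right and left steps after the first one; |x| < t makes A and B
    -- nonnegative.
    obtain ⟨A, hA⟩ := Int.eq_ofNat_of_zero_le (show 0 ≤ l by omega)
    obtain ⟨B, hB⟩ := Int.eq_ofNat_of_zero_le (show 0 ≤ j - l - 1 by omega)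
    have hn : (j : ℝ) = A + B + 1 := by
      have : j = A + B + 1 := by omega
      exact_mod_cast this
    have hi : (i : ℝ) = A - B := by
      have : i = A - B := by omega
      exact_mod_cast this
    have h1 := (h A B j v μ hn hμ0 hμ1 hvd).1 (by rw [hvj, hi])
    have h2 := FeynmanCheckers.a₁_eq (m := m) hε A B
    rw [show ((A : ℝ) + B + 2) * ε = j * ε + ε by rw [hn]; ring, ← hi] at h2
    rw [h2, hx, FeynmanCheckers.amplitude_eq hm hε hj hv1, FeynmanCheckers.theta_eq hε hj]
    convert h1 using 2
    rw [FeynmanCheckers.wave]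
    ring
  · rintro ⟨k, hk, hk'⟩
    obtain ⟨l, hl⟩ : Even (i + j) := by rwa [Int.cast_injective hk']
    obtain ⟨A, hA⟩ := Int.eq_ofNat_of_zero_le (show 0 ≤ l by omega)
    obtain ⟨B, hB⟩ := Int.eq_ofNat_of_zero_le (show 0 ≤ j - l - 1 by omega)
    have hn : (j : ℝ) = A + B + 1 := by
      have : j = A + B + 1 := by omega
      exact_mod_cast this
    have hi : (i : ℝ) = A - B - 1 := by
      have : i = A - B - 1 := by omega
      exact_mod_cast this
    have h1 := (h A B j v μ hn hμ0 hμ1 hvd).2 (by rw [hvj, hi])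
    have h2 := FeynmanCheckers.a₂_eq (m := m) hε A B
    rw [show ((A : ℝ) + B + 2) * ε = j * ε + ε by rw [hn]; ring,
      show ((A : ℝ) - B) * ε = i * ε + ε by rw [hi]; ring] at h2
    have h3 : (j * ε + i * ε) / (j * ε - i * ε) = (1 + v) / (1 - v) := by
      have : 0 < 1 - v := by linarith
      rw [hx, show j * ε + v * j * ε = (j * ε) * (1 + v) by ring,
        show j * ε - v * j * ε = (j * ε) * (1 - v) by ring, mul_div_mul_left _ _ ht0.ne']
    rw [h2, h3, hx, FeynmanCheckers.amplitude_eq hm hε hj hv1, FeynmanCheckers.theta_eq hε hj]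
    convert h1 using 2
    rw [FeynmanCheckers.wave]
    ring
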